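/- Let $J,R,Q\in\mathbb R^{n\times n}$, $B,P\in\mathbb R^{n\times m}$, $D\in\mathbb R^{m\times m}$ and $S:=\tfrac12(D+D^\top)$ satisfy $J=-J^\top$, $R=R^\top\ge 0$, $Q=Q^\top\ge0$, $S\ge 0$ and $$W:=\begin{pmatrix}QRQ&QP\\P^\top Q&S\end{pmatrix}\ge 0 .$$ Let $\mathbb U\subset\mathbb R^m$ be convex and compact with $0\in\operatorname{int}\mathbb U$, and let $\Phi\subset\mathbb R^n$ be closed. For $T>0$ and $x^0\in\mathbb R^n$ consider the optimal control problem $$\min_{u\in L^1(0,T;\mathbb U)}\int_0^T u(t)^\top y(t)\,dt,\quad \dot x=(J-R)Qx+(B-P)u,\quad y=(B+P)^\top Qx+Du,\quad x(0)=x^0,\ x(T)\in\Phi. \tag{OCP}$$ Assume that $((J-R)Q,B-P)$ is controllable (i.e. its Kalman matrix has rank $n$) and that $0$ can be steered into $\Phi$ by an $L^1$-control with values in $\mathbb U$; fix a time $T_1\ge 0$ at which this is possible. Let $T_0(x^0)$ be the minimal time in which $x^0$ can be steered to $0$ by an $L^1$-control with values in $\mathbb U$, and put $T(x^0):=T_0(x^0)+T_1$.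 Then for every $t_c>0$ there is a continuous function $G:\mathbb R^n\to[0,\infty)$ (depending only on the system matrices, $\mathbb U$, $\Phi$, $T_1$ and $t_c$) such that the following holds for all $x^0\in\mathbb R^n$ and all $T$ with $T>T(x^0)$ and $t_c<T/4$. Let $(x^\star,u^\star)$ be an optimal pair of (OCP), and let $\lambda_0^\star\le 0$ and $\lambda^\star\in W^{1,1}(0,T;\mathbb R^n)$ satisfy, together with $(x^\star,u^\star)$, the Pontryagin necessary optimality conditions for the Hamiltonian $$\mathcal H(x,u,\lambda,\lambda_0)=\lambda^\top\big((J-R)Qx+(B-P)u\big)+\lambda_0\begin{pmatrix}x\\u\end{pmatrix}^{\!\top} W\begin{pmatrix}x\\u\end{pmatrix},$$ that is, $(\lambda_0^\star,\lambda^\star(t))\ne 0$ for all $t\in[0,T]$, and for a.e. $t\in[0,T]$ $$\dot\lambda^\star(t)=-\mathcal H_x(x^\star(t),u^\star(t),\lambda^\star(t),\lambda_0^\star),\qquad u^\star(t)\in\arg\max_{u\in\mathbb U}\mathcal H(x^\star(t),u,\lambda^\star(t),\lambda_0^\star).$$ If $u^\star(t)\in\operatorname{int}\mathbb U$ for a.e.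 $t\in[t_c,T-t_c]$, then $$\int_{2t_c}^{T-t_c}\|\lambda^\star(t)\|^2\,dt\le(\lambda_0^\star)^2\,G(x^0).$$ In particular, for the normalisation $\lambda_0^\star=-1$ the bound is $G(x^0)$, i.e. the adjoint has a turnpike towards zero. -/

import Mathlib

open MeasureTheory Set
open scoped Matrix Gradient

/-- A port-Hamiltonian ODE system with feed-through,
`ẋ = (J - R) Q x + (B - P) u`, `y = (B + P)ᵀ Q x + D u`, with `n` states and `m` inputs. -/
structure PHSystem (n m : ℕ) where
  J : Matrix (Fin n) (Fin n) ℝ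
  R : Matrix (Fin n) (Fin n) ℝ
  Q : Matrix (Fin n) (Fin n) ℝ
  B : Matrix (Fin n) (Fin m) ℝ
  P : Matrix (Fin n) (Fin m) ℝ
  D : Matrix (Fin m) (Fin m) ℝ
  J_skew : J = -Jᵀ
  R_posSemidef : R.PosSemidef
  Q_posSemidef : Q.PosSemidef
  S_posSemidef : ((1 / 2 : ℝ) • (D + Dᵀ)).PosSemidef
  W_posSemidef :
    (Matrix.fromBlocks (Q * R * Q) (Q * P) (Pᵀ * Q) ((1 / 2 : ℝ) • (D + Dᵀ))).PosSemidef

namespace PHSystem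

variable {n m : ℕ}

/-- The system matrix `A = (J - R) Q`. -/
def A (sys : PHSystem n m) : Matrix (Fin n) (Fin n) ℝ := (sys.J - sys.R) * sys.Q

/-- The input matrix `B - P`. -/
def inputMatrix (sys : PHSystem n m) : Matrix (Fin n) (Fin m) ℝ := sys.B - sys.P

/-- The symmetric part `S` of the feed-through matrix `D`. -/
noncomputable def S (sys : PHSystem n m) : Matrix (Fin m) (Fin m) ℝ :=
  (1 / 2 : ℝ) • (sys.D + sys.Dᵀ)

/-- The dissipation matrix `W = (QRQ, QP; PᵀQ, S)`. -/
noncomputable def W (sys : PHSystem n m) : Matrix (Fin n ⊕ Fin m) (Fin n ⊕ Fin m) ℝ :=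
  Matrix.fromBlocks (sys.Q * sys.R * sys.Q) (sys.Q * sys.P) (sys.Pᵀ * sys.Q) sys.S

/-- The Kalman matrix `(B - P, A (B - P), …, A ^ (n - 1) (B - P))`; its columns are indexed by
pairs (block, column inside the block). -/
def kalmanMatrix (sys : PHSystem n m) : Matrix (Fin n) (Fin n × Fin m) ℝ :=
  Matrix.of fun i p => (sys.A ^ (p.1 : ℕ) * sys.inputMatrix) i p.2

/-- Controllability of the pair `((J - R) Q, B - P)`: the Kalman matrix has full rank. -/
def IsControllable (sys : PHSystem n m) : Prop := sys.kalmanMatrix.rank = n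

/-- The vector field `(J - R) Q x + (B - P) u` of the dynamics. -/
noncomputable def dynamics (sys : PHSystem n m) (x : EuclideanSpace ℝ (Fin n))
    (u : EuclideanSpace ℝ (Fin m)) : EuclideanSpace ℝ (Fin n) :=
  Matrix.toEuclideanLin sys.A x + Matrix.toEuclideanLin sys.inputMatrix u

/-- The output `y = (B + P)ᵀ Q x + D u`. -/
noncomputable def output (sys : PHSystem n m) (x : EuclideanSpace ℝ (Fin n))
    (u : EuclideanSpace ℝ (Fin m)) : EuclideanSpace ℝ (Fin m) :=
  Matrix.toEuclideanLin ((sys.B + sys.P)ᵀ * sys.Q) x + Matrix.toEuclideanLin sys.D u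

/-- The dissipation rate `‖W ^ (1/2) (x, u)‖² = (x, u)ᵀ W (x, u)`. -/
noncomputable def dissipation (sys : PHSystem n m) (x : EuclideanSpace ℝ (Fin n))
    (u : EuclideanSpace ℝ (Fin m)) : ℝ :=
  Sum.elim x.ofLp u.ofLp ⬝ᵥ (sys.W *ᵥ Sum.elim x.ofLp u.ofLp)

/-- The optimal control Hamiltonian
`λᵀ ((J - R) Q x + (B - P) u) + λ₀ ‖W ^ (1/2) (x, u)‖²`. -/
noncomputable def controlHamiltonian (sys : PHSystem n m) (x : EuclideanSpace ℝ (Fin n))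
    (u : EuclideanSpace ℝ (Fin m)) (lam : EuclideanSpace ℝ (Fin n)) (lam₀ : ℝ) : ℝ :=
  inner ℝ lam (sys.dynamics x u) + lam₀ * sys.dissipation x u

end PHSystem

/-- `f` is (the continuous representative of) an element of `W^{1,1}(0, T)` with derivative `g`:
it is absolutely continuous on `[0, T]` and `f' = g` almost everywhere. -/
def IsW11Solution {n : ℕ} (T : ℝ) (f g : ℝ → EuclideanSpace ℝ (Fin n)) : Prop :=
  AbsolutelyContinuousOnInterval f 0 T ∧
    ∀ᵐ t ∂volume.restrict (Icc 0 T), HasDerivAt f (g t) t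

/-- `u ∈ L¹(0, T; U)`. -/
def IsControl {m : ℕ} (U : Set (EuclideanSpace ℝ (Fin m))) (T : ℝ)
    (u : ℝ → EuclideanSpace ℝ (Fin m)) : Prop :=
  IntegrableOn u (Icc 0 T) ∧ ∀ᵐ t ∂volume.restrict (Icc 0 T), u t ∈ U

namespace PHSystem

variable {n m : ℕ}

/-- `(x, u)` is an input-state pair on `[0, T]`: `u ∈ L¹(0, T; U)` and `x` is the solution of
`ẋ = (J - R) Q x + (B - P) u`, `x(0) = x₀`. -/
def IsPair (sys : PHSystem n m) (U : Set (EuclideanSpace ℝ (Fin m))) (T : ℝ)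
    (x₀ : EuclideanSpace ℝ (Fin n)) (x : ℝ → EuclideanSpace ℝ (Fin n))
    (u : ℝ → EuclideanSpace ℝ (Fin m)) : Prop :=
  IsControl U T u ∧ x 0 = x₀ ∧ IsW11Solution T x (fun t => sys.dynamics (x t) (u t))

/-- The set `C_t(Φ)` of states that can be steered into `Φ` at time `t`. -/
def steerableAt (sys : PHSystem n m) (U : Set (EuclideanSpace ℝ (Fin m))) (t : ℝ)
    (Φ : Set (EuclideanSpace ℝ (Fin n))) : Set (EuclideanSpace ℝ (Fin n)) :=
  {x₀ | ∃ x u, sys.IsPair U t x₀ x u ∧ x t ∈ Φ}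

/-- The minimal time at which `z` can be reached from `x₀`. -/
noncomputable def minTime (sys : PHSystem n m) (U : Set (EuclideanSpace ℝ (Fin m)))
    (x₀ z : EuclideanSpace ℝ (Fin n)) : ℝ :=
  sInf {t : ℝ | 0 ≤ t ∧ x₀ ∈ sys.steerableAt U t {z}}

/-- The supplied energy `∫₀ᵀ u(t)ᵀ y(t) dt`. -/
noncomputable def suppliedEnergy (sys : PHSystem n m) (T : ℝ)
    (x : ℝ → EuclideanSpace ℝ (Fin n)) (u : ℝ → EuclideanSpace ℝ (Fin m)) : ℝ :=
  ∫ t in (0 : ℝ)..T, inner ℝ (u t) (sys.output (x t) (u t))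

/-- `(x, u)` is an optimal pair of the problem of minimising the supplied energy over all
input-state pairs on `[0, T]` that start at `x₀` and end in `Φ`. -/
def IsOptimalPair (sys : PHSystem n m) (U : Set (EuclideanSpace ℝ (Fin m)))
    (Φ : Set (EuclideanSpace ℝ (Fin n))) (T : ℝ) (x₀ : EuclideanSpace ℝ (Fin n))
    (x : ℝ → EuclideanSpace ℝ (Fin n)) (u : ℝ → EuclideanSpace ℝ (Fin m)) : Prop :=
  (sys.IsPair U T x₀ x u ∧ x T ∈ Φ) ∧
    ∀ x' u', sys.IsPair U T x₀ x' u' → x' T ∈ Φ →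
      sys.suppliedEnergy T x u ≤ sys.suppliedEnergy T x' u'

/-- `(lam₀, lam)` are multipliers for the pair `(x, u)` in the sense of the Pontryagin maximum
principle: `lam₀ ≤ 0`, `(lam₀, lam(t)) ≠ 0` for all `t`, `lam ∈ W^{1,1}` solves the adjoint equation
`lam' = -∂ₓ controlHamiltonian`, and `u(t)` maximises the control Hamiltonian over `U` for
almost every `t`. (The state equation is part of `IsPair`.) -/
structure IsAdjoint (sys : PHSystem n m) (U : Set (EuclideanSpace ℝ (Fin m))) (T : ℝ)
    (x : ℝ → EuclideanSpace ℝ (Fin n)) (u : ℝ → EuclideanSpace ℝ (Fin m))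
    (lam : ℝ → EuclideanSpace ℝ (Fin n)) (lam₀ : ℝ) : Prop where
  nonpos : lam₀ ≤ 0
  nontrivial : ∀ t ∈ Icc 0 T, (lam₀, lam t) ≠ 0
  adjoint_eq : IsW11Solution T lam
    (fun t => -∇ (fun ξ => sys.controlHamiltonian ξ (u t) (lam t) lam₀) (x t))
  maximum : ∀ᵐ t ∂volume.restrict (Icc 0 T), u t ∈ U ∧
    IsMaxOn (fun v => sys.controlHamiltonian (x t) v (lam t) lam₀) U (u t)

end PHSystem

/-! The supplied energy along a pair is the gain in stored energy `½ xᵀQx` plus the dissipated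
energy. A competitor that steers `x₀` to `0`, rests there without dissipating, and spends the last
`T₁` reaching `Φ` has a cost bounded independently of `T` up to the common initial energy. As stored
energy is nonnegative, an optimal pair dissipates a bounded amount
(`eventually_integral_dissipation_le`).

Bounds locally uniform in `x₀` need every state to be steerable to `0` with controls in `U`
(`exists_mem_steerableAt_zero`). If one were not, a separating functional moved along `q' = -Aᵀq`
would have observations `(B - P)ᵀq` that fade out. By observability `q` would then become small, but
the port-Hamiltonian structure keeps it away from zero (`exists_adjoint_norm_ge`).

Write `(w₁, w₂) = W(x, u)`. The adjoint equation reads `λ' = -Aᵀλ - 2λ₀w₁`, and where `u` is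
interior the maximum condition gives `(B - P)ᵀλ = -2λ₀w₂`. Both right-hand terms are controlled by
the dissipation, because `‖Wz‖² ≤ C zᵀWz`. Observability on a window of length `tc` therefore bounds
`‖λ(t)‖²` by `λ₀²` times the energy dissipated in `[t - tc, t]` (`exists_adjoint_norm_sq_le`).
Integration over `t` costs a factor `tc`, and a partition of unity turns the local bounds into a
continuous `G`. -/

section AbsolutelyContinuous

/-! ### Absolutely continuous curves and integration by parts. -/

namespace AbsolutelyContinuousOnInterval

/-- Monotonicity keeps disjoint intervals disjoint and `hdist` does not lengthen them. The clamps
`min r t` and `max r t - t` are the intended `φ`, for concatenating trajectories. -/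
theorem comp_monotone {X : Type*} [PseudoMetricSpace X] {f : ℝ → X} {φ : ℝ → ℝ} {a b c d : ℝ}
    (hf : AbsolutelyContinuousOnInterval f c d) (hφ : Monotone φ)
    (hdist : ∀ x y, dist (φ x) (φ y) ≤ dist x y) (hmaps : MapsTo φ (uIcc a b) (uIcc c d)) :
    AbsolutelyContinuousOnInterval (fun t => f (φ t)) a b := by
  rw [absolutelyContinuousOnInterval_iff] at hf ⊢
  intro ε hε
  obtain ⟨δ, hδ, H⟩ := hf ε hε
  refine ⟨δ, hδ, fun I hI hlen => ?_⟩
  refine H (I.1, fun i => (φ (I.2 i).1, φ (I.2 i).2)) ⟨fun i hi => ?_, fun i hi j hj hij => ?_⟩ ?_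
  · exact ⟨hmaps (hI.1 i hi).1, hmaps (hI.1 i hi).2⟩
  · have h := hI.2 hi hj hij
    simp only [Function.onFun, uIoc, Ioc_disjoint_Ioc] at h ⊢
    simp only [← hφ.map_max, ← hφ.map_min]
    exact hφ h
  · exact (Finset.sum_le_sum fun i _ => hdist _ _).trans_lt hlen

theorem comp_lipschitz {X Y : Type*} [PseudoMetricSpace X] [PseudoMetricSpace Y] {f : ℝ → X}
    {g : X → Y} {K : NNReal} {a b : ℝ} (hg : LipschitzWith K g)
    (hf : AbsolutelyContinuousOnInterval f a b) :
    AbsolutelyContinuousOnInterval (fun t => g (f t)) a b := by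
  refine squeeze_zero (fun I => Finset.sum_nonneg fun i _ => dist_nonneg) (fun I => ?_)
    (by simpa using Filter.Tendsto.const_mul (K : ℝ) hf)
  rw [Finset.mul_sum]
  exact Finset.sum_le_sum fun i _ => hg.dist_le_mul _ _

theorem fun_sum {ι : Type*} (s : Finset ι) {f : ι → ℝ → ℝ} {a b : ℝ}
    (hf : ∀ i ∈ s, AbsolutelyContinuousOnInterval (f i) a b) :
    AbsolutelyContinuousOnInterval (fun t => ∑ i ∈ s, f i t) a b := by
  classical
  induction s using Finset.induction_on with
  | empty =>
    simpa using (LipschitzWith.const (0 : ℝ)).lipschitzOnWith.absolutelyContinuousOnInterval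
  | insert i s hi ih =>
    simp only [Finset.sum_insert hi]
    exact (hf i (by simp)).fun_add (ih fun j hj => hf j (by simp [hj]))

theorem fun_inner {n : ℕ} {f g : ℝ → EuclideanSpace ℝ (Fin n)} {a b : ℝ}
    (hf : AbsolutelyContinuousOnInterval f a b) (hg : AbsolutelyContinuousOnInterval g a b) :
    AbsolutelyContinuousOnInterval (fun t => inner ℝ (f t) (g t)) a b := by
  have key : ∀ {f : ℝ → EuclideanSpace ℝ (Fin n)}, AbsolutelyContinuousOnInterval f a b → ∀ i,
      AbsolutelyContinuousOnInterval (fun t => f t i) a b := fun hf i =>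
    comp_lipschitz (EuclideanSpace.proj (𝕜 := ℝ) i).lipschitz hf
  simp only [PiLp.inner_apply, RCLike.inner_apply, conj_trivial]
  exact fun_sum _ fun i _ => (key hg i).fun_mul (key hf i)

theorem integral_eq_sub_of_ae_hasDerivAt {f g : ℝ → ℝ} {a b : ℝ}
    (hf : AbsolutelyContinuousOnInterval f a b)
    (hg : ∀ᵐ t ∂volume.restrict (uIoc a b), HasDerivAt f (g t) t) :
    IntervalIntegrable g volume a b ∧ ∫ t in a..b, g t = f b - f a := by
  have h : deriv f =ᵐ[volume.restrict (uIoc a b)] g := by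
    filter_upwards [hg] with t ht using ht.deriv
  refine ⟨hf.intervalIntegrable_deriv.congr_ae h, ?_⟩
  rw [← hf.integral_deriv_eq_sub]
  exact intervalIntegral.integral_congr_ae_restrict h.symm

end AbsolutelyContinuousOnInterval

theorem absolutelyContinuousOnInterval_of_hasDerivAt {E : Type*} [NormedAddCommGroup E]
    [NormedSpace ℝ E] {f f' : ℝ → E} (hf : ∀ t, HasDerivAt f (f' t) t) (hf' : Continuous f')
    (a b : ℝ) : AbsolutelyContinuousOnInterval f a b := by
  have : ContDiff ℝ 1 f := by
    rw [contDiff_one_iff_deriv]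
    refine ⟨fun t => (hf t).differentiableAt, ?_⟩
    rwa [show deriv f = f' from funext fun t => (hf t).deriv]
  exact this.contDiffOn.absolutelyContinuousOnInterval

/-- Fundamental theorem of calculus for the inner product of two absolutely continuous curves. -/
theorem integral_inner_add_inner_eq_sub {n : ℕ} {f g f' g' : ℝ → EuclideanSpace ℝ (Fin n)}
    {a b : ℝ} (hf : AbsolutelyContinuousOnInterval f a b)
    (hg : AbsolutelyContinuousOnInterval g a b)
    (hf' : ∀ᵐ t ∂volume.restrict (uIoc a b), HasDerivAt f (f' t) t)
    (hg' : ∀ᵐ t ∂volume.restrict (uIoc a b), HasDerivAt g (g' t) t) :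
    IntervalIntegrable (fun t => inner ℝ (f t) (g' t) + inner ℝ (f' t) (g t)) volume a b ∧
    ∫ t in a..b, (inner ℝ (f t) (g' t) + inner ℝ (f' t) (g t)) =
      inner ℝ (f b) (g b) - inner ℝ (f a) (g a) := by
  refine (hf.fun_inner hg).integral_eq_sub_of_ae_hasDerivAt ?_
  filter_upwards [hf', hg'] with t h1 h2 using h1.inner ℝ h2

end AbsolutelyContinuous

/-! ### Linear control systems: duality, steering and lower bounds on flows. -/

section LinearControl

open ContinuousLinearMap Topology

variable {E F : Type*} [NormedAddCommGroup E] [InnerProductSpace ℝ E] [FiniteDimensional ℝ E]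
  [NormedAddCommGroup F] [InnerProductSpace ℝ F] [FiniteDimensional ℝ F]

/-- The flow `exp (t A)` of a linear vector field. -/
noncomputable def linearFlow (A : E →L[ℝ] E) (t : ℝ) : E →L[ℝ] E := NormedSpace.exp (t • A)

omit [FiniteDimensional ℝ E] in
theorem linearFlow_zero (A : E →L[ℝ] E) : linearFlow A 0 = 1 := by
  simp [linearFlow]

theorem hasDerivAt_linearFlow (A : E →L[ℝ] E) (t : ℝ) :
    HasDerivAt (linearFlow A) (A * linearFlow A t) t :=
  have := FiniteDimensional.complete ℝ E
  hasDerivAt_exp_smul_const' A t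

theorem continuous_linearFlow (A : E →L[ℝ] E) : Continuous (linearFlow A) :=
  continuous_iff_continuousAt.2 fun t => (hasDerivAt_linearFlow A t).continuousAt

theorem linearFlow_mul_linearFlow_neg (A : E →L[ℝ] E) (t : ℝ) :
    linearFlow A t * linearFlow A (-t) = 1 := by
  have := FiniteDimensional.complete ℝ E
  let _ : NormedAlgebra ℚ (E →L[ℝ] E) := NormedAlgebra.restrictScalars ℚ ℝ _
  rw [linearFlow, linearFlow, ← NormedSpace.exp_add_of_commute]
  · simp
  · exact ((Commute.refl A).smul_left _).smul_right _

theorem hasDerivAt_linearFlow_apply (A : E →L[ℝ] E) (c : ℝ) (z : E) (t : ℝ) :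
    HasDerivAt (fun s => linearFlow A (s - c) z) (A (linearFlow A (t - c) z)) t := by
  have h := ((hasDerivAt_linearFlow A (t - c)).comp_sub_const t c).clm_apply
    (hasDerivAt_const t z)
  simpa using h

omit [FiniteDimensional ℝ F] in
-- Variation of constants. The base time `c` is free, so that terminal values can be prescribed too.
theorem exists_solution_of_continuous (A : E →L[ℝ] E) (B : F →L[ℝ] E) {v : ℝ → F}
    (hv : Continuous v) (c : ℝ) (z : E) :
    ∃ ξ : ℝ → E, (∀ t, HasDerivAt ξ (A (ξ t) + B (v t)) t) ∧ ξ c = z := by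
  have := FiniteDimensional.complete ℝ E
  let h : ℝ → E := fun r => linearFlow A (-r) (B (v r))
  have hh : Continuous h :=
    ((continuous_linearFlow A).comp continuous_neg).clm_apply (B.continuous.comp hv)
  have hd : ∀ t, HasDerivAt (fun s => linearFlow A (-c) z + ∫ r in c..s, h r) (h t) t := fun t =>
    (intervalIntegral.integral_hasDerivAt_right (hh.intervalIntegrable _ _)
      (hh.stronglyMeasurableAtFilter _ _) hh.continuousAt).const_add _
  refine ⟨fun s => linearFlow A s (linearFlow A (-c) z + ∫ r in c..s, h r), fun t => ?_, ?_⟩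
  · convert! (hasDerivAt_linearFlow A t).clm_apply (hd t) using 1
    have := congrArg (fun L : E →L[ℝ] E => L (B (v t))) (linearFlow_mul_linearFlow_neg A t)
    simp only [mul_apply_eq_comp, one_apply_eq_self] at this
    simp [h, this]
  · have := congrArg (fun L : E →L[ℝ] E => L z) (linearFlow_mul_linearFlow_neg A c)
    simpa using this

/-- The Kalman observability condition for the pair `(Aᵀ, Bᵀ)`. -/
def KalmanCondition (A : E →L[ℝ] E) (B : F →L[ℝ] E) : Prop :=
  ∀ z : E, (∀ k : ℕ, adjoint B ((adjoint A ^ k) z) = 0) → z = 0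

/-- Needed for the time-reversed system, which converts steering from zero into steering to zero. -/
theorem KalmanCondition.neg {A : E →L[ℝ] E} {B : F →L[ℝ] E} (h : KalmanCondition A B) :
    KalmanCondition (-A) (-B) := by
  intro z hz
  refine h z fun k => ?_
  have := hz k
  rw [map_neg, map_neg, neg_pow] at this
  rcases neg_one_pow_eq_or (E →L[ℝ] E) k with h | h <;> simpa [h] using this

/-- Differentiating `Bᵀp = 0` repeatedly along `p' = -Aᵀp` gives `Bᵀ(Aᵀ)ᵏp = 0` for every `k`. -/
theorem KalmanCondition.eq_zero_of_eqOn {A : E →L[ℝ] E} {B : F →L[ℝ] E} (h : KalmanCondition A B)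
    {p : ℝ → E} (hp : ∀ t, HasDerivAt p (-(adjoint A (p t))) t) {s : Set ℝ} (hs : IsOpen s)
    (h0 : ∀ t ∈ s, adjoint B (p t) = 0) {t : ℝ} (ht : t ∈ s) : p t = 0 := by
  have key : ∀ k : ℕ, ∀ t ∈ s, adjoint B ((adjoint A ^ k) (p t)) = 0 := by
    intro k
    induction k with
    | zero => simpa using h0
    | succ k ih =>
      intro t ht
      have h1 : HasDerivAt (fun r => adjoint B ((adjoint A ^ k) (p r)))
          (adjoint B ((adjoint A ^ k) (-(adjoint A (p t))))) t :=
        (adjoint B).hasFDerivAt.comp_hasDerivAt t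
          ((adjoint A ^ k).hasFDerivAt.comp_hasDerivAt t (hp t))
      have h2 : HasDerivAt (fun r => adjoint B ((adjoint A ^ k) (p r))) 0 t :=
        (hasDerivAt_const t (0 : F)).congr_of_eventuallyEq
          (Filter.eventuallyEq_of_mem (hs.mem_nhds ht) ih)
      have h3 := h1.unique h2
      rw [pow_succ]
      simpa using h3
  exact h _ fun k => key k t ht

/-- The drift terms cancel, leaving only the control paired with the observation `Bᵀp`. This duality
drives the steering arguments. -/
theorem hasDerivAt_inner_adjoint {A : E →L[ℝ] E} {B : F →L[ℝ] E} {p ξ : ℝ → E} {v : F} {t : ℝ}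
    (hp : HasDerivAt p (-(adjoint A (p t))) t) (hξ : HasDerivAt ξ (A (ξ t) + B v) t) :
    HasDerivAt (fun s => inner ℝ (p s) (ξ s)) (inner ℝ (adjoint B (p t)) v) t := by
  convert! hp.inner ℝ hξ using 1
  simp [inner_add_right, inner_neg_left, adjoint_inner_left]

theorem integral_inner_adjoint {A : E →L[ℝ] E} {B : F →L[ℝ] E} {p ξ : ℝ → E} {v : ℝ → F}
    (hv : Continuous v) (hp : ∀ t, HasDerivAt p (-(adjoint A (p t))) t)
    (hξ : ∀ t, HasDerivAt ξ (A (ξ t) + B (v t)) t) (a b : ℝ) :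
    ∫ t in a..b, inner ℝ (adjoint B (p t)) (v t) = inner ℝ (p b) (ξ b) - inner ℝ (p a) (ξ a) := by
  have hpc : Continuous p := continuous_iff_continuousAt.2 fun t => (hp t).continuousAt
  refine intervalIntegral.integral_eq_sub_of_hasDerivAt
    (fun t _ => hasDerivAt_inner_adjoint (hp t) (hξ t)) (Continuous.intervalIntegrable ?_ _ _)
  fun_prop

/-- Let `z` be orthogonal to the reachable subspace, and let `p` be the adjoint solution with `p c =
z`. The control `Bᵀp` reaches a state orthogonal to `z`, so duality gives `∫ ‖Bᵀp‖² = 0`.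
Observability then gives `p = 0` on `(0, c)`, and continuity gives `z = 0`. -/
theorem KalmanCondition.exists_steering {A : E →L[ℝ] E} {B : F →L[ℝ] E} (h : KalmanCondition A B)
    {c : ℝ} (hc : 0 < c) (z : E) :
    ∃ (v : ℝ → F) (ξ : ℝ → E), Continuous v ∧ (∀ t, HasDerivAt ξ (A (ξ t) + B (v t)) t) ∧
      ξ 0 = 0 ∧ ξ c = z := by
  have := FiniteDimensional.complete ℝ E
  let V : Submodule ℝ E :=
    { carrier := {z | ∃ (v : ℝ → F) (ξ : ℝ → E), Continuous v ∧
        (∀ t, HasDerivAt ξ (A (ξ t) + B (v t)) t) ∧ ξ 0 = 0 ∧ ξ c = z}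
      add_mem' := by
        rintro _ _ ⟨v, ξ, hv, hξ, h0, rfl⟩ ⟨v', ξ', hv', hξ', h0', rfl⟩
        refine ⟨v + v', ξ + ξ', hv.add hv', fun t => ?_, by simp [h0, h0'], rfl⟩
        convert! (hξ t).add (hξ' t) using 1
        simp only [Pi.add_apply, map_add]
        abel
      zero_mem' := ⟨0, 0, continuous_const, fun t => by simp,
        rfl, rfl⟩
      smul_mem' := by
        rintro a _ ⟨v, ξ, hv, hξ, h0, rfl⟩
        refine ⟨a • v, a • ξ, hv.const_smul a, fun t => ?_, by simp [h0], rfl⟩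
        convert! (hξ t).const_smul a using 1
        simp }
  suffices hV : V = ⊤ from (hV ▸ Submodule.mem_top : z ∈ V)
  rw [← Submodule.orthogonal_eq_bot_iff, Submodule.eq_bot_iff]
  intro z hz
  let p : ℝ → E := fun s => linearFlow (-(adjoint A)) (s - c) z
  have hp : ∀ t, HasDerivAt p (-(adjoint A (p t))) t := fun t =>
    hasDerivAt_linearFlow_apply (-(adjoint A)) c z t
  have hpc : p c = z := by simp [p, linearFlow_zero]
  have hpcont : Continuous p := continuous_iff_continuousAt.2 fun t => (hp t).continuousAt
  have hv : Continuous fun t => adjoint B (p t) := by fun_prop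
  obtain ⟨ξ, hξ, h0⟩ := exists_solution_of_continuous A B hv 0 0
  have hint := integral_inner_adjoint hv hp hξ 0 c
  have hzero : inner ℝ (p c) (ξ c) = 0 := by
    rw [hpc, real_inner_comm]
    exact (Submodule.mem_orthogonal V z).1 hz _ ⟨_, ξ, hv, hξ, h0, rfl⟩
  rw [hzero, h0, inner_zero_right, sub_zero] at hint
  have hBp : ∀ t ∈ Ioo 0 c, adjoint B (p t) = 0 := by
    by_contra! hcon
    obtain ⟨t, ht, hne⟩ := hcon
    have : 0 < ∫ t in (0 : ℝ)..c, inner ℝ (adjoint B (p t)) (adjoint B (p t)) :=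
      intervalIntegral.integral_pos hc (by fun_prop) (fun _ _ => real_inner_self_nonneg)
        ⟨t, Ioo_subset_Icc_self ht, real_inner_self_pos.2 hne⟩
    exact this.ne' hint
  have hps : ∀ t ∈ Ioo 0 c, p t = 0 := fun t ht => h.eq_zero_of_eqOn hp isOpen_Ioo hBp ht
  rw [← hpc]
  have hcl : c ∈ closure (Ioo 0 c) := by rw [closure_Ioo hc.ne]; exact ⟨hc.le, le_rfl⟩
  exact (isClosed_eq hpcont continuous_const).closure_subset_iff.2 hps hcl

omit [FiniteDimensional ℝ E] in
theorem OrthonormalBasis.norm_sum_inner_smul_le {ι G : Type*} [Fintype ι] [NormedAddCommGroup G]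
    [NormedSpace ℝ G] (b : OrthonormalBasis ι ℝ E) (z : E) {w : ι → G} {K : ι → ℝ}
    (hw : ∀ i, ‖w i‖ ≤ K i) : ‖∑ i, inner ℝ (b i) z • w i‖ ≤ (∑ i, K i + 1) * ‖z‖ :=
  calc ‖∑ i, inner ℝ (b i) z • w i‖ ≤ ∑ i, ‖inner ℝ (b i) z • w i‖ := norm_sum_le _ _
    _ ≤ ∑ i, K i * ‖z‖ := Finset.sum_le_sum fun i _ => by
        rw [norm_smul, Real.norm_eq_abs, mul_comm]
        refine mul_le_mul (hw i) ?_ (abs_nonneg _) ((norm_nonneg _).trans (hw i))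
        simpa [b.norm_eq_one] using abs_real_inner_le_norm (b i) z
    _ = (∑ i, K i) * ‖z‖ := by rw [Finset.sum_mul]
    _ ≤ _ := by gcongr; linarith

theorem KalmanCondition.exists_bounded_steering {A : E →L[ℝ] E} {B : F →L[ℝ] E}
    (h : KalmanCondition A B) {c : ℝ} (hc : 0 < c) :
    ∃ M : ℝ, 0 < M ∧ ∀ z : E, ∃ (v : ℝ → F) (ξ : ℝ → E), Continuous v ∧
      (∀ t, HasDerivAt ξ (A (ξ t) + B (v t)) t) ∧ ξ 0 = 0 ∧ ξ c = z ∧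
      ∀ t ∈ Icc 0 c, ‖v t‖ ≤ M * ‖z‖ ∧ ‖ξ t‖ ≤ M * ‖z‖ := by
  let b := stdOrthonormalBasis ℝ E
  choose v ξ hv hξ h0 h1 using fun i => h.exists_steering hc (b i)
  have hξc : ∀ i, Continuous (ξ i) := fun i =>
    continuous_iff_continuousAt.2 fun t => (hξ i t).continuousAt
  have hK : ∀ i, ∃ K : ℝ, ∀ t ∈ Icc 0 c, ‖v i t‖ ≤ K ∧ ‖ξ i t‖ ≤ K := by
    intro i
    obtain ⟨K, hK⟩ := (isCompact_Icc (a := 0) (b := c)).exists_bound_of_continuousOn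
      ((hv i).prodMk (hξc i)).continuousOn
    exact ⟨K, fun t ht => ⟨(_root_.norm_fst_le _).trans (hK t ht), (_root_.norm_snd_le _).trans (hK t ht)⟩⟩
  choose K hK using hK
  have hK0 : ∀ i, 0 ≤ K i := fun i => (norm_nonneg _).trans (hK i 0 ⟨le_rfl, hc.le⟩).1
  have hsum : 0 ≤ ∑ i, K i := Finset.sum_nonneg fun i _ => hK0 i
  -- Superposing the steerings of an orthonormal basis makes the bound linear in `‖z‖`. The `+ 1`
  -- keeps the constant positive even when `E` is trivial.
  refine ⟨∑ i, K i + 1, by linarith, fun z => ⟨fun t => ∑ i, inner ℝ (b i) z • v i t,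
    fun t => ∑ i, inner ℝ (b i) z • ξ i t, by fun_prop, fun t => ?_, by simp [h0], ?_,
    fun t ht => ⟨b.norm_sum_inner_smul_le z fun i => (hK i t ht).1,
      b.norm_sum_inner_smul_le z fun i => (hK i t ht).2⟩⟩⟩
  · convert! HasDerivAt.fun_sum (fun i (_ : i ∈ Finset.univ) => (hξ i t).const_smul (inner ℝ (b i) z))
      using 1
    simp [Finset.sum_add_distrib]
  · simp only [h1]
    exact b.sum_repr' z

/-- Along `q' = Q K q` with `Q` positive semidefinite and `K` monotone, some solution through any
nonzero initial value stays away from zero in forward time. -/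
theorem exists_solution_norm_ge (Q K : E →L[ℝ] E) (hQs : ∀ x y, inner ℝ (Q x) y = inner ℝ x (Q y))
    (hQ : ∀ x, 0 ≤ inner ℝ x (Q x)) (hQ0 : ∀ x, inner ℝ x (Q x) = 0 → Q x = 0)
    (hK : ∀ x, 0 ≤ inner ℝ x (K x)) {p : E} (hp : p ≠ 0) :
    ∃ (q : ℝ → E) (δ : ℝ), 0 < δ ∧ (∀ t, HasDerivAt q (Q (K (q t))) t) ∧ q 0 = p ∧
      ∀ t, 0 ≤ t → δ ≤ ‖q t‖ := by
  have := FiniteDimensional.complete ℝ E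
  by_cases hr : p ∈ LinearMap.range (Q : E →ₗ[ℝ] E)
  · obtain ⟨η₀, hη₀⟩ := hr
    simp only [coe_coe] at hη₀
    let η : ℝ → E := fun s => linearFlow (K * Q) (s - 0) η₀
    have hη : ∀ t, HasDerivAt η (K (Q (η t))) t := fun t =>
      hasDerivAt_linearFlow_apply (K * Q) 0 η₀ t
    have hη0 : η 0 = η₀ := by simp [η, linearFlow_zero]
    have hd : ∀ t, HasDerivAt (fun s => Q (η s)) (Q (K (Q (η t)))) t := fun t =>
      Q.hasFDerivAt.comp_hasDerivAt t (hη t)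
    -- For `p = Q η₀`, the lift `η' = KQη` has energy `⟨η, Qη⟩` with derivative `2⟨Qη, KQη⟩ ≥ 0`.
    have hmono : Monotone fun s => inner ℝ (η s) (Q (η s)) := by
      refine monotone_of_hasDerivAt_nonneg (fun t => (hη t).inner ℝ (hd t)) fun t => ?_
      simp only [Pi.zero_apply]
      rw [← hQs, real_inner_comm (Q (η t)) (K (Q (η t)))]
      have := hK (Q (η t))
      linarith
    -- A linear section of `Q` over its range bounds the energy by a multiple of `‖Qx‖²`, so growing
    -- energy keeps `q = Qη` away from zero.
    obtain ⟨g, hg⟩ := LinearMap.exists_rightInverse_of_surjective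
      (Q : E →ₗ[ℝ] E).rangeRestrict (LinearMap.range_rangeRestrict _)
    let g' : LinearMap.range (Q : E →ₗ[ℝ] E) →L[ℝ] E := g.toContinuousLinearMap
    have hE : ∀ x, inner ℝ x (Q x) ≤ ‖g'‖ * ‖Q x‖ ^ 2 := by
      intro x
      let w : LinearMap.range (Q : E →ₗ[ℝ] E) := ⟨Q x, x, rfl⟩
      have hw : Q (g' w) = Q x := congrArg Subtype.val (LinearMap.congr_fun hg w)
      have hwn : ‖w‖ = ‖Q x‖ := rfl
      calc inner ℝ x (Q x) = inner ℝ (Q x) (g' w) := by rw [hQs, hw]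
        _ ≤ ‖Q x‖ * ‖g' w‖ := real_inner_le_norm _ _
        _ ≤ ‖Q x‖ * (‖g'‖ * ‖w‖) := by gcongr; exact g'.le_opNorm w
        _ = _ := by rw [hwn]; ring
    have hpos : 0 < inner ℝ η₀ (Q η₀) :=
      lt_of_le_of_ne (hQ _) fun h0 => hp (hη₀ ▸ hQ0 _ h0.symm)
    set e := inner ℝ η₀ (Q η₀) with he
    refine ⟨fun s => Q (η s), Real.sqrt (e / (‖g'‖ + 1)), by positivity, hd,
      by simp [hη0, hη₀], fun t ht => ?_⟩
    refine Real.sqrt_le_iff.2 ⟨norm_nonneg _, ?_⟩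
    have h1 : e ≤ inner ℝ (η t) (Q (η t)) := by simpa [hη0] using hmono ht
    have h2 := hE (η t)
    rw [div_le_iff₀ (by positivity)]
    nlinarith [sq_nonneg ‖Q (η t)‖]
  -- Off the range of `Q`, the component `z` of `p` orthogonal to the range is nonzero and is
  -- conserved, since `q'` lies in the range.
  · let V := LinearMap.range (Q : E →ₗ[ℝ] E)
    obtain ⟨y, hy, z, hz, hyz⟩ := V.exists_add_mem_mem_orthogonal p
    have hz0 : z ≠ 0 := by
      rintro rfl
      exact hr (by rw [hyz, add_zero]; exact hy)
    have hQz : ∀ x, inner ℝ z (Q x) = 0 := fun x => by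
      rw [real_inner_comm]
      exact (Submodule.mem_orthogonal V z).1 hz _ ⟨x, rfl⟩
    let q : ℝ → E := fun s => linearFlow (Q * K) (s - 0) p
    have hq : ∀ t, HasDerivAt q (Q (K (q t))) t := fun t =>
      hasDerivAt_linearFlow_apply (Q * K) 0 p t
    have hq0 : q 0 = p := by simp [q, linearFlow_zero]
    have hconst : ∀ t, inner ℝ z (q t) = inner ℝ z (q 0) := by
      have hder : ∀ t, HasDerivAt (fun s => inner ℝ z (q s)) 0 t := fun t => by
        simpa [hQz] using (hasDerivAt_const t z).inner ℝ (hq t)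
      exact fun t => is_const_of_deriv_eq_zero (fun s => (hder s).differentiableAt)
        (fun s => (hder s).deriv) t 0
    have hzp : inner ℝ z p = ‖z‖ * ‖z‖ := by
      rw [hyz, inner_add_right, real_inner_self_eq_norm_mul_norm, real_inner_comm,
        (Submodule.mem_orthogonal V z).1 hz y hy, zero_add]
    refine ⟨q, ‖z‖, norm_pos_iff.2 hz0, hq, hq0, fun t _ => ?_⟩
    have h1 := real_inner_le_norm z (q t)
    rw [hconst, hq0, hzp] at h1
    exact le_of_mul_le_mul_left h1 (norm_pos_iff.2 hz0)

end LinearControl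

/-! ### Matrices as operators on Euclidean space. -/

section MatrixForms

open Matrix ContinuousLinearMap

theorem inner_toEuclideanLin_right {k l : ℕ} (M : Matrix (Fin k) (Fin l) ℝ)
    (x : EuclideanSpace ℝ (Fin k)) (y : EuclideanSpace ℝ (Fin l)) :
    inner ℝ x (toEuclideanLin M y) = inner ℝ (toEuclideanLin Mᵀ x) y := by
  simp only [EuclideanSpace.inner_eq_star_dotProduct, toLpLin_apply, star_trivial]
  rw [mulVec_transpose, dotProduct_comm, dotProduct_mulVec, dotProduct_comm]

theorem toEuclideanLin_mul_apply {k l m : ℕ} (M : Matrix (Fin k) (Fin l) ℝ)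
    (N : Matrix (Fin l) (Fin m) ℝ) (x : EuclideanSpace ℝ (Fin m)) :
    toEuclideanLin (M * N) x = toEuclideanLin M (toEuclideanLin N x) := by
  simp [toLpLin_apply]

theorem adjoint_toEuclideanLin {k l : ℕ} (M : Matrix (Fin k) (Fin l) ℝ) :
    adjoint (toEuclideanLin M).toContinuousLinearMap =
      (toEuclideanLin Mᵀ).toContinuousLinearMap := by
  refine (eq_adjoint_iff _ _).2 (fun x y => ?_) |>.symm
  simpa using (inner_toEuclideanLin_right M x y).symm

/-- With `M = LᴴL`, the form is `‖Lv‖²` and `‖Mv‖ ≤ ‖Lᴴ‖ ‖Lv‖`. -/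
theorem Matrix.PosSemidef.exists_norm_sq_le {ι : Type*} [Fintype ι] [DecidableEq ι]
    {M : Matrix ι ι ℝ} (hM : M.PosSemidef) :
    ∃ C : ℝ, 0 ≤ C ∧ ∀ v : ι → ℝ, (M *ᵥ v) ⬝ᵥ (M *ᵥ v) ≤ C * (v ⬝ᵥ (M *ᵥ v)) := by
  obtain ⟨L, rfl⟩ : ∃ L : Matrix ι ι ℝ, M = Lᴴ * L := by
    open scoped MatrixOrder in
    exact CStarAlgebra.nonneg_iff_eq_star_mul_self.1 hM.nonneg
  let T := (toEuclideanLin Lᴴ).toContinuousLinearMap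
  refine ⟨‖T‖ ^ 2, by positivity, fun v => ?_⟩
  have hn : ∀ y : EuclideanSpace ℝ ι, y.ofLp ⬝ᵥ y.ofLp = ‖y‖ ^ 2 := fun y => by
    rw [← real_inner_self_eq_norm_sq, EuclideanSpace.inner_eq_star_dotProduct]
    rfl
  have h1 : v ⬝ᵥ ((Lᴴ * L) *ᵥ v) = ‖(WithLp.toLp 2 (L *ᵥ v) : EuclideanSpace ℝ ι)‖ ^ 2 := by
    rw [← hn, ← mulVec_mulVec, dotProduct_mulVec, conjTranspose_eq_transpose_of_trivial,
      vecMul_transpose]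
  have h2 : ((Lᴴ * L) *ᵥ v) ⬝ᵥ ((Lᴴ * L) *ᵥ v) = ‖T (WithLp.toLp 2 (L *ᵥ v))‖ ^ 2 := by
    rw [← hn, ← mulVec_mulVec]
    rfl
  rw [h1, h2, ← mul_pow]
  exact pow_le_pow_left₀ (norm_nonneg _) (T.le_opNorm _) 2

end MatrixForms

/-! ### Power balance, Kalman condition and derivatives of the Hamiltonian. -/

namespace PHSystem

open Matrix ContinuousLinearMap

variable {n m : ℕ} (sys : PHSystem n m)

/-- The drift `x ↦ (J - R) Q x` as a continuous linear map. -/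
noncomputable def driftCLM : EuclideanSpace ℝ (Fin n) →L[ℝ] EuclideanSpace ℝ (Fin n) :=
  (toEuclideanLin sys.A).toContinuousLinearMap

/-- The input operator `u ↦ (B - P) u` as a continuous linear map. -/
noncomputable def inputCLM : EuclideanSpace ℝ (Fin m) →L[ℝ] EuclideanSpace ℝ (Fin n) :=
  (toEuclideanLin sys.inputMatrix).toContinuousLinearMap

/-- The state component of `W (x, u)`. -/
noncomputable def dissState (x : EuclideanSpace ℝ (Fin n)) (u : EuclideanSpace ℝ (Fin m)) :
    EuclideanSpace ℝ (Fin n) :=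
  toEuclideanLin (sys.Q * sys.R * sys.Q) x + toEuclideanLin (sys.Q * sys.P) u

/-- The input component of `W (x, u)`. -/
noncomputable def dissInput (x : EuclideanSpace ℝ (Fin n)) (u : EuclideanSpace ℝ (Fin m)) :
    EuclideanSpace ℝ (Fin m) :=
  toEuclideanLin (sys.Pᵀ * sys.Q) x + toEuclideanLin sys.S u

theorem dynamics_eq (x : EuclideanSpace ℝ (Fin n)) (u : EuclideanSpace ℝ (Fin m)) :
    sys.dynamics x u = sys.driftCLM x + sys.inputCLM u := rfl

theorem Q_transpose : sys.Qᵀ = sys.Q := sys.Q_posSemidef.1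

theorem R_transpose : sys.Rᵀ = sys.R := sys.R_posSemidef.1

theorem S_transpose : sys.Sᵀ = sys.S := sys.S_posSemidef.1

theorem J_transpose : sys.Jᵀ = -sys.J := by
  conv_rhs => rw [sys.J_skew, neg_neg]

theorem W_mulVec (x : EuclideanSpace ℝ (Fin n)) (u : EuclideanSpace ℝ (Fin m)) :
    sys.W *ᵥ Sum.elim x.ofLp u.ofLp =
      Sum.elim (sys.dissState x u).ofLp (sys.dissInput x u).ofLp := by
  rw [W, fromBlocks_mulVec]
  simp [dissState, dissInput, Matrix.mul_assoc]

theorem dissipation_eq (x : EuclideanSpace ℝ (Fin n)) (u : EuclideanSpace ℝ (Fin m)) :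
    sys.dissipation x u = inner ℝ x (sys.dissState x u) + inner ℝ u (sys.dissInput x u) := by
  rw [dissipation, W_mulVec, sumElim_dotProduct_sumElim]
  simp only [EuclideanSpace.inner_eq_star_dotProduct, star_trivial]
  rw [dotProduct_comm, dotProduct_comm u.ofLp]

theorem dissipation_nonneg (x : EuclideanSpace ℝ (Fin n)) (u : EuclideanSpace ℝ (Fin m)) :
    0 ≤ sys.dissipation x u := by
  have h := sys.W_posSemidef.dotProduct_mulVec_nonneg (Sum.elim x.ofLp u.ofLp)
  rwa [star_trivial] at h

theorem exists_norm_diss_sq_le : ∃ C : ℝ, 0 ≤ C ∧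
    ∀ (x : EuclideanSpace ℝ (Fin n)) (u : EuclideanSpace ℝ (Fin m)),
      ‖sys.dissState x u‖ ^ 2 + ‖sys.dissInput x u‖ ^ 2 ≤ C * sys.dissipation x u := by
  obtain ⟨C, hC, h⟩ := sys.W_posSemidef.exists_norm_sq_le
  refine ⟨C, hC, fun x u => ?_⟩
  have := h (Sum.elim x.ofLp u.ofLp)
  change (sys.W *ᵥ _) ⬝ᵥ (sys.W *ᵥ _) ≤ C * sys.dissipation x u at this
  rw [W_mulVec, sumElim_dotProduct_sumElim] at this
  rw [← real_inner_self_eq_norm_sq, ← real_inner_self_eq_norm_sq]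
  simpa only [EuclideanSpace.inner_eq_star_dotProduct, star_trivial] using this

theorem inner_J_self (x : EuclideanSpace ℝ (Fin n)) :
    inner ℝ x (toEuclideanLin sys.J x) = 0 := by
  have h := inner_toEuclideanLin_right sys.J x x
  rw [J_transpose, map_neg, LinearMap.neg_apply, inner_neg_left, real_inner_comm] at h
  rw [real_inner_comm]
  linarith

/-- The power balance `uᵀ y = d/dt (½ xᵀ Q x) + ‖W ^ (1/2) (x, u)‖²`. -/
theorem inner_output (x : EuclideanSpace ℝ (Fin n)) (u : EuclideanSpace ℝ (Fin m)) :
    inner ℝ u (sys.output x u) =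
      inner ℝ (toEuclideanLin sys.Q x) (sys.dynamics x u) + sys.dissipation x u := by
  have hD : inner ℝ u (toEuclideanLin sys.Dᵀ u) = inner ℝ u (toEuclideanLin sys.D u) := by
    rw [inner_toEuclideanLin_right, transpose_transpose, real_inner_comm]
  have hx : ∀ y, inner ℝ x (toEuclideanLin sys.Q y) = inner ℝ (toEuclideanLin sys.Q x) y :=
    fun y => by rw [inner_toEuclideanLin_right, Q_transpose]
  have hu : ∀ (M : Matrix (Fin n) (Fin m) ℝ) y,
      inner ℝ u (toEuclideanLin Mᵀ y) = inner ℝ y (toEuclideanLin M u) := fun M y => by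
    rw [inner_toEuclideanLin_right, transpose_transpose, real_inner_comm]
  have hJ := sys.inner_J_self (toEuclideanLin sys.Q x)
  simp only [dissipation_eq, output, dynamics, dissState, dissInput, A, inputMatrix, S,
    toEuclideanLin_mul_apply, map_add, map_sub, map_smul, transpose_add, LinearMap.add_apply,
    LinearMap.sub_apply, LinearMap.smul_apply, inner_add_right, inner_sub_right, inner_smul_right,
    hx, hu, hD, hJ]
  ring

theorem continuous_dissipation : Continuous fun z : EuclideanSpace ℝ (Fin n) ×
    EuclideanSpace ℝ (Fin m) => sys.dissipation z.1 z.2 := by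
  have h1 := fun M : Matrix (Fin n) (Fin n) ℝ => (toEuclideanLin M).continuous_of_finiteDimensional
  have h2 := fun M : Matrix (Fin n) (Fin m) ℝ => (toEuclideanLin M).continuous_of_finiteDimensional
  have h3 := fun M : Matrix (Fin m) (Fin n) ℝ => (toEuclideanLin M).continuous_of_finiteDimensional
  have h4 := fun M : Matrix (Fin m) (Fin m) ℝ => (toEuclideanLin M).continuous_of_finiteDimensional
  simp only [dissipation_eq, dissState, dissInput]
  fun_prop

/-- Full row rank makes left multiplication by the Kalman matrix injective; only the powers `k < n`
are used. -/
theorem kalmanCondition (h : sys.IsControllable) : KalmanCondition sys.driftCLM sys.inputCLM := by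
  intro z hz
  have hpow : ∀ k : ℕ, (adjoint sys.driftCLM ^ k) z = toEuclideanLin (sys.Aᵀ ^ k) z := by
    intro k
    induction k with
    | zero => simp
    | succ k ih =>
      rw [pow_succ', pow_succ', toEuclideanLin_mul_apply, ← ih, driftCLM, adjoint_toEuclideanLin]
      rfl
  have hK : z.ofLp ᵥ* sys.kalmanMatrix = 0 := by
    ext ⟨k, j⟩
    have h1 := hz k
    rw [hpow, inputCLM, adjoint_toEuclideanLin] at h1
    have h2 : toEuclideanLin (sys.inputMatrixᵀ * sys.Aᵀ ^ (k : ℕ)) z = 0 := by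
      rw [toEuclideanLin_mul_apply]
      exact h1
    rw [← transpose_pow, ← transpose_mul] at h2
    have h3 := congrFun (congrArg WithLp.ofLp h2) j
    rw [toLpLin_apply, mulVec_transpose] at h3
    exact h3
  have hrow : LinearIndependent ℝ sys.kalmanMatrix.row := by
    rw [linearIndependent_iff_card_eq_finrank_span, Fintype.card_fin, Set.finrank,
      ← rank_eq_finrank_span_row]
    exact h.symm
  have hinj := vecMul_injective_iff.2 hrow
  have : z.ofLp = 0 := hinj (by simpa using hK)
  ext i
  simp [this]

theorem hasFDerivAt_dissipation_state (x : EuclideanSpace ℝ (Fin n))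
    (u : EuclideanSpace ℝ (Fin m)) : HasFDerivAt (fun ξ => sys.dissipation ξ u)
      ((2 : ℝ) • innerSL ℝ (sys.dissState x u)) x := by
  let K := (toEuclideanLin (sys.Q * sys.R * sys.Q)).toContinuousLinearMap
  let N := (toEuclideanLin (sys.Pᵀ * sys.Q)).toContinuousLinearMap
  have h1 : HasFDerivAt (fun ξ => sys.dissState ξ u) K x := K.hasFDerivAt.add_const _
  have h2 : HasFDerivAt (fun ξ => sys.dissInput ξ u) N x := N.hasFDerivAt.add_const _
  have h := ((hasFDerivAt_id x).inner ℝ h1).add ((hasFDerivAt_const u x).inner ℝ h2)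
  simp only [dissipation_eq]
  refine h.congr_fderiv ?_
  ext v
  have e1 : inner ℝ x (toEuclideanLin (sys.Q * sys.R * sys.Q) v) =
      inner ℝ v (toEuclideanLin (sys.Q * sys.R * sys.Q) x) := by
    rw [inner_toEuclideanLin_right, real_inner_comm]
    simp only [transpose_mul, Q_transpose, R_transpose, Matrix.mul_assoc]
  have e2 : inner ℝ u (toEuclideanLin (sys.Pᵀ * sys.Q) v) =
      inner ℝ v (toEuclideanLin (sys.Q * sys.P) u) := by
    rw [inner_toEuclideanLin_right, real_inner_comm]
    simp only [transpose_mul, Q_transpose, transpose_transpose]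
  simp [K, N, dissState, inner_add_right, real_inner_comm v] at e1 e2 ⊢
  linarith

theorem hasFDerivAt_dissipation_input (x : EuclideanSpace ℝ (Fin n))
    (u : EuclideanSpace ℝ (Fin m)) : HasFDerivAt (fun v => sys.dissipation x v)
      ((2 : ℝ) • innerSL ℝ (sys.dissInput x u)) u := by
  let K := (toEuclideanLin (sys.Q * sys.P)).toContinuousLinearMap
  let N := (toEuclideanLin sys.S).toContinuousLinearMap
  have h1 : HasFDerivAt (fun v => sys.dissState x v) K u := K.hasFDerivAt.const_add _
  have h2 : HasFDerivAt (fun v => sys.dissInput x v) N u := N.hasFDerivAt.const_add _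
  have h := ((hasFDerivAt_const x u).inner ℝ h1).add ((hasFDerivAt_id u).inner ℝ h2)
  simp only [dissipation_eq]
  refine h.congr_fderiv ?_
  ext v
  have e1 : inner ℝ x (toEuclideanLin (sys.Q * sys.P) v) =
      inner ℝ v (toEuclideanLin (sys.Pᵀ * sys.Q) x) := by
    rw [inner_toEuclideanLin_right, real_inner_comm]
    simp only [transpose_mul, Q_transpose]
  have e2 : inner ℝ u (toEuclideanLin sys.S v) = inner ℝ v (toEuclideanLin sys.S u) := by
    rw [inner_toEuclideanLin_right, real_inner_comm, S_transpose]
  simp [K, N, dissInput, inner_add_right, real_inner_comm v] at e1 e2 ⊢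
  linarith

theorem gradient_controlHamiltonian (x lam : EuclideanSpace ℝ (Fin n))
    (u : EuclideanSpace ℝ (Fin m)) (lam₀ : ℝ) :
    ∇ (fun ξ => sys.controlHamiltonian ξ u lam lam₀) x =
      adjoint sys.driftCLM lam + (2 * lam₀) • sys.dissState x u := by
  refine HasGradientAt.gradient ?_
  rw [hasGradientAt_iff_hasFDerivAt]
  have h1 : HasFDerivAt (fun ξ => sys.dynamics ξ u) sys.driftCLM x :=
    sys.driftCLM.hasFDerivAt.add_const _
  have h := ((hasFDerivAt_const lam x).inner ℝ h1).add
    ((sys.hasFDerivAt_dissipation_state x u).const_mul lam₀)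
  refine h.congr_fderiv ?_
  ext v
  simp [adjoint_inner_left]
  ring

/-- First-order condition: the input derivative of the Hamiltonian vanishes at an interior
maximiser. -/
theorem adjoint_inputCLM_eq_of_isMaxOn {U : Set (EuclideanSpace ℝ (Fin m))}
    {x lam : EuclideanSpace ℝ (Fin n)} {u : EuclideanSpace ℝ (Fin m)} {lam₀ : ℝ}
    (hu : u ∈ interior U) (hmax : IsMaxOn (fun v => sys.controlHamiltonian x v lam lam₀) U u) :
    adjoint sys.inputCLM lam = -(2 * lam₀) • sys.dissInput x u := by
  have h1 : HasFDerivAt (fun v => sys.dynamics x v) sys.inputCLM u :=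
    sys.inputCLM.hasFDerivAt.const_add _
  have h := ((hasFDerivAt_const lam u).inner ℝ h1).add
    ((sys.hasFDerivAt_dissipation_input x u).const_mul lam₀)
  have hz := (hmax.isLocalMax (mem_interior_iff_mem_nhds.1 hu)).hasFDerivAt_eq_zero h
  refine ext_inner_right ℝ fun v => ?_
  have := DFunLike.congr_fun hz v
  simp [adjoint_inner_left, inner_smul_left] at this ⊢
  linarith

end PHSystem

/-! ### Concatenation of curves. -/

section Concat

/-- The curve that follows `f` up to time `t` and then `g`, restarted at time `0`. -/
noncomputable def concatAt {X : Type*} (t : ℝ) (f g : ℝ → X) (r : ℝ) : X :=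
  if r ≤ t then f r else g (r - t)

variable {X : Type*} {t s : ℝ} {f g : ℝ → X}

theorem concatAt_of_le {r : ℝ} (h : r ≤ t) : concatAt t f g r = f r := if_pos h

theorem concatAt_of_lt {r : ℝ} (h : t < r) : concatAt t f g r = g (r - t) := if_neg h.not_ge

theorem concatAt_add_of_pos {r : ℝ} (h : 0 < r) : concatAt t f g (r + t) = g r := by
  rw [concatAt_of_lt (by linarith), add_sub_cancel_right]

theorem concatAt_add (hs : 0 ≤ s) (hfg : g 0 = f t) : concatAt t f g (t + s) = g s := by
  rcases hs.eq_or_lt with rfl | hs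
  · rw [add_zero, concatAt_of_le le_rfl, hfg]
  · rw [add_comm, concatAt_add_of_pos hs]

/-- The junction time is a null set and is discarded, as the concatenated curve need not be
differentiable there. -/
theorem ae_restrict_Icc_concat {p : ℝ → Prop}
    (h1 : ∀ᵐ r ∂volume.restrict (Icc 0 t), r < t → p r)
    (h2 : ∀ᵐ r ∂volume.restrict (Icc 0 s), 0 < r → p (r + t)) :
    ∀ᵐ r ∂volume.restrict (Icc 0 (t + s)), p r := by
  rw [ae_restrict_iff' measurableSet_Icc] at h1 h2 ⊢
  have h3 := (measurePreserving_sub_right volume t).quasiMeasurePreserving.ae h2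
  filter_upwards [h1, h3, Measure.ae_ne volume t] with r a1 a2 a3 hr
  rcases lt_or_gt_of_ne a3 with h | h
  · exact a1 ⟨hr.1, h.le⟩ h
  · simpa using a2 ⟨by linarith, by linarith [hr.2]⟩ (by linarith)

theorem AbsolutelyContinuousOnInterval.concatAt {F : Type*} [NormedAddCommGroup F] {f g : ℝ → F}
    (ht : 0 ≤ t) (hs : 0 ≤ s) (hf : AbsolutelyContinuousOnInterval f 0 t)
    (hg : AbsolutelyContinuousOnInterval g 0 s) (hfg : g 0 = f t) :
    AbsolutelyContinuousOnInterval (concatAt t f g) 0 (t + s) := by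
  have h1 : AbsolutelyContinuousOnInterval (fun r => f (min r t)) 0 (t + s) := by
    refine hf.comp_monotone (fun x y h => min_le_min_right t h) (fun x y => ?_) ?_
    · simpa [Real.dist_eq] using abs_min_sub_min_le_max x t y t
    · rw [uIcc_of_le (by linarith), uIcc_of_le ht]
      exact fun r hr => ⟨le_min hr.1 ht, min_le_right _ _⟩
  have h2 : AbsolutelyContinuousOnInterval (fun r => g (max r t - t)) 0 (t + s) := by
    refine hg.comp_monotone (fun x y h => sub_le_sub_right (max_le_max_right t h) t)
      (fun x y => ?_) ?_
    · simpa [Real.dist_eq] using abs_max_sub_max_le_max x t y t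
    · rw [uIcc_of_le (by linarith), uIcc_of_le hs]
      exact fun r hr => ⟨by linarith [le_max_right r t],
        by linarith [max_le hr.2 (by linarith : t ≤ t + s)]⟩
  have h3 : AbsolutelyContinuousOnInterval (fun _ : ℝ => g 0) 0 (t + s) :=
    (LipschitzWith.const (g 0)).lipschitzOnWith.absolutelyContinuousOnInterval
  -- The concatenation equals `f (min r t) + g (max r t - t) - g 0`.
  convert! (h1.fun_add h2).fun_sub h3 using 1
  ext1 r
  rcases le_or_gt r t with h | h
  · simp [concatAt_of_le h, min_eq_left h, max_eq_right h]
  · simp [concatAt_of_lt h, min_eq_right h.le, max_eq_left h.le, hfg]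

theorem integral_concatAt {F : Type*} [NormedAddCommGroup F] [NormedSpace ℝ F] {f g : ℝ → F}
    (ht : 0 ≤ t) (hs : 0 ≤ s) (hf : IntervalIntegrable f volume 0 t)
    (hg : IntervalIntegrable g volume 0 s) :
    IntervalIntegrable (concatAt t f g) volume 0 (t + s) ∧
      ∫ r in (0 : ℝ)..(t + s), concatAt t f g r =
        (∫ r in (0 : ℝ)..t, f r) + ∫ r in (0 : ℝ)..s, g r := by
  have e1 : EqOn f (concatAt t f g) (uIoc 0 t) := fun r hr => by
    rw [uIoc_of_le ht] at hr
    exact (concatAt_of_le hr.2).symm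
  have e2 : EqOn (fun r => g (r - t)) (concatAt t f g) (uIoc t (t + s)) := fun r hr => by
    rw [uIoc_of_le (by linarith)] at hr
    exact (concatAt_of_lt hr.1).symm
  have hg' : IntervalIntegrable (fun r => g (r - t)) volume t (t + s) := by
    simpa [add_comm] using hg.comp_sub_right t
  have i1 := hf.congr e1
  have i2 := hg'.congr e2
  refine ⟨i1.trans i2, ?_⟩
  rw [← intervalIntegral.integral_add_adjacent_intervals i1 i2]
  congr 1
  · exact intervalIntegral.integral_congr_ae (ae_of_all _ fun r hr => (e1 hr).symm)
  · rw [intervalIntegral.integral_congr_ae (ae_of_all _ fun r hr => (e2 hr).symm),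
      intervalIntegral.integral_comp_sub_right]
    simp

end Concat

/-! ### Input-state pairs: concatenation, energy balance and a priori bounds. -/

namespace PHSystem

open ContinuousLinearMap

variable {n m : ℕ} {sys : PHSystem n m} {U : Set (EuclideanSpace ℝ (Fin m))} {t s T : ℝ}
  {x₀ : EuclideanSpace ℝ (Fin n)} {x x' : ℝ → EuclideanSpace ℝ (Fin n)}
  {u u' : ℝ → EuclideanSpace ℝ (Fin m)}

theorem isPair_of_hasDerivAt (hu : Continuous u) (huU : ∀ r ∈ Icc 0 T, u r ∈ U)
    (hx : ∀ r, HasDerivAt x (sys.driftCLM (x r) + sys.inputCLM (u r)) r) :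
    sys.IsPair U T (x 0) x u := by
  have hxc : Continuous x := continuous_iff_continuousAt.2 fun r => (hx r).continuousAt
  refine ⟨⟨hu.continuousOn.integrableOn_Icc, ?_⟩, rfl,
    absolutelyContinuousOnInterval_of_hasDerivAt hx (by fun_prop) _ _, ae_of_all _ hx⟩
  exact (ae_restrict_iff' measurableSet_Icc).2 (ae_of_all _ huU)

theorem isPair_zero (hU : (0 : EuclideanSpace ℝ (Fin m)) ∈ U) (T : ℝ) :
    sys.IsPair U T 0 (fun _ => 0) (fun _ => 0) :=
  isPair_of_hasDerivAt (x := fun _ => 0) continuous_const (fun _ _ => hU)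
    fun r => by simpa using hasDerivAt_const r (0 : EuclideanSpace ℝ (Fin n))

theorem IsPair.concatAt (ht : 0 ≤ t) (hs : 0 ≤ s) (h : sys.IsPair U t x₀ x u)
    (h' : sys.IsPair U s (x t) x' u') :
    sys.IsPair U (t + s) x₀ (concatAt t x x') (concatAt t u u') := by
  obtain ⟨⟨hui, huU⟩, hx0, hac, hx⟩ := h
  obtain ⟨⟨hui', huU'⟩, hx0', hac', hx'⟩ := h'
  refine ⟨⟨?_, ?_⟩, ?_, hac.concatAt ht hs hac' hx0', ?_⟩
  · rw [← intervalIntegrable_iff_integrableOn_Icc_of_le (by linarith)]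
    exact (integral_concatAt ht hs
      ((intervalIntegrable_iff_integrableOn_Icc_of_le ht).2 hui)
      ((intervalIntegrable_iff_integrableOn_Icc_of_le hs).2 hui')).1
  · refine ae_restrict_Icc_concat ?_ ?_
    · filter_upwards [huU] with r hr hrt
      rwa [concatAt_of_le hrt.le]
    · filter_upwards [huU'] with r hr hrt
      rwa [concatAt_add_of_pos hrt]
  · rw [concatAt_of_le ht, hx0]
  · refine ae_restrict_Icc_concat ?_ ?_
    · filter_upwards [hx] with r hr hrt
      rw [concatAt_of_le hrt.le, concatAt_of_le hrt.le]
      refine hr.congr_of_eventuallyEq ?_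
      filter_upwards [Iio_mem_nhds hrt] with y hy using concatAt_of_le (le_of_lt hy)
    · filter_upwards [hx'] with r hr hrt
      rw [concatAt_add_of_pos hrt, concatAt_add_of_pos hrt]
      have h1 : HasDerivAt (fun y => x' (y - t)) (sys.dynamics (x' r) (u' r)) (r + t) := by
        refine HasDerivAt.comp_sub_const (r + t) t ?_
        rwa [add_sub_cancel_right]
      refine h1.congr_of_eventuallyEq ?_
      filter_upwards [Ioi_mem_nhds (show t < r + t by linarith)] with y hy
        using concatAt_of_lt hy

theorem convex_steerableAt (hU : Convex ℝ U) (T : ℝ) {Φ : Set (EuclideanSpace ℝ (Fin n))}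
    (hΦ : Convex ℝ Φ) : Convex ℝ (sys.steerableAt U T Φ) := by
  rintro _ ⟨x, u, ⟨⟨hui, huU⟩, rfl, hac, hx⟩, hxT⟩ _ ⟨x', u', ⟨⟨hui', huU'⟩, rfl, hac', hx'⟩, hxT'⟩
    a b ha hb hab
  refine ⟨fun r => a • x r + b • x' r, fun r => a • u r + b • u' r,
    ⟨⟨(hui.smul a).add (hui'.smul b), ?_⟩, rfl, (hac.const_smul a).fun_add (hac'.const_smul b), ?_⟩,
    hΦ hxT hxT' ha hb hab⟩
  · filter_upwards [huU, huU'] with r h h' using hU h h' ha hb hab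
  · filter_upwards [hx, hx'] with r h h'
    convert! (h.const_smul a).add (h'.const_smul b) using 1
    simp only [dynamics_eq, map_add, map_smul, smul_add]
    abel

theorem steerableAt_zero_mono (hU : (0 : EuclideanSpace ℝ (Fin m)) ∈ U) (ht : 0 ≤ t)
    (hts : t ≤ s) : sys.steerableAt U t {0} ⊆ sys.steerableAt U s {0} := by
  rintro _ ⟨x, u, h, hxt⟩
  rw [mem_singleton_iff] at hxt
  have h' : sys.IsPair U (s - t) (x t) (fun _ => 0) (fun _ => 0) := by
    rw [hxt]
    exact isPair_zero hU _
  have hc := h.concatAt ht (sub_nonneg.2 hts) h'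
  have he := concatAt_add (f := x) (g := fun _ => 0) (sub_nonneg.2 hts) hxt.symm
  rw [add_sub_cancel] at hc he
  exact ⟨_, _, hc, he⟩

theorem IsPair.continuousOn (hT : 0 ≤ T) (h : sys.IsPair U T x₀ x u) : ContinuousOn x (Icc 0 T) := by
  rw [← uIcc_of_le hT]
  exact h.2.2.1.continuousOn

theorem IsPair.intervalIntegrable_comp (hU : IsCompact U) (hT : 0 ≤ T)
    (h : sys.IsPair U T x₀ x u)
    {φ : EuclideanSpace ℝ (Fin n) × EuclideanSpace ℝ (Fin m) → ℝ} (hφ : Continuous φ) :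
    IntervalIntegrable (fun r => φ (x r, u r)) volume 0 T := by
  rw [intervalIntegrable_iff_integrableOn_Icc_of_le hT]
  have hx := h.continuousOn hT
  obtain ⟨K, hK⟩ := ((isCompact_Icc.image_of_continuousOn hx).prod hU).exists_bound_of_continuousOn
    hφ.continuousOn
  refine Integrable.of_bound ?_ K ?_
  · exact hφ.comp_aestronglyMeasurable
      ((hx.aestronglyMeasurable measurableSet_Icc).prodMk h.1.1.aestronglyMeasurable)
  · filter_upwards [h.1.2, ae_restrict_mem measurableSet_Icc] with r hu hr
    exact hK _ ⟨mem_image_of_mem x hr, hu⟩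

theorem IsPair.ae_hasDerivAt (h : sys.IsPair U T x₀ x u) (ht : 0 ≤ t) (hts : t ≤ s)
    (hs : s ≤ T) : ∀ᵐ r ∂volume.restrict (uIoc t s), HasDerivAt x (sys.dynamics (x r) (u r)) r := by
  refine ae_restrict_of_ae_restrict_of_subset ?_ h.2.2.2
  rw [uIoc_of_le hts]
  exact fun r hr => ⟨ht.trans hr.1.le, hr.2.trans hs⟩

/-- The stored energy `½ xᵀ Q x`. -/
noncomputable def storedEnergy (sys : PHSystem n m) (x : EuclideanSpace ℝ (Fin n)) : ℝ :=
  1 / 2 * inner ℝ (Matrix.toEuclideanLin sys.Q x) x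

theorem inner_Q_nonneg (sys : PHSystem n m) (x : EuclideanSpace ℝ (Fin n)) :
    0 ≤ inner ℝ (Matrix.toEuclideanLin sys.Q x) x := by
  have h := sys.Q_posSemidef.dotProduct_mulVec_nonneg x.ofLp
  rw [star_trivial] at h
  simpa [EuclideanSpace.inner_eq_star_dotProduct, Matrix.toLpLin_apply] using h

theorem storedEnergy_nonneg (x : EuclideanSpace ℝ (Fin n)) : 0 ≤ sys.storedEnergy x :=
  mul_nonneg (by norm_num) (sys.inner_Q_nonneg x)

theorem IsPair.suppliedEnergy_eq (hU : IsCompact U) (hT : 0 ≤ T) (h : sys.IsPair U T x₀ x u) :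
    sys.suppliedEnergy T x u = sys.storedEnergy (x T) - sys.storedEnergy x₀ +
      ∫ r in (0 : ℝ)..T, sys.dissipation (x r) (u r) := by
  let Qc := (Matrix.toEuclideanLin sys.Q).toContinuousLinearMap
  have hx := h.ae_hasDerivAt le_rfl hT le_rfl
  have hQx : ∀ᵐ r ∂volume.restrict (uIoc 0 T),
      HasDerivAt (fun r => Qc (x r)) (Qc (sys.dynamics (x r) (u r))) r := by
    filter_upwards [hx] with r hr using Qc.hasFDerivAt.comp_hasDerivAt r hr
  have hsymm : ∀ a b, inner ℝ (Qc a) b = inner ℝ (Qc b) a := fun a b => by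
    have := inner_toEuclideanLin_right sys.Q b a
    rw [Q_transpose, real_inner_comm] at this
    exact this
  obtain ⟨-, hint⟩ := integral_inner_add_inner_eq_sub
    (AbsolutelyContinuousOnInterval.comp_lipschitz Qc.lipschitz h.2.2.1) h.2.2.1 hQx hx
  have hd := h.intervalIntegrable_comp hU hT sys.continuous_dissipation
  have hp := h.intervalIntegrable_comp hU hT (φ := fun z => inner ℝ (Qc z.1) (sys.dynamics z.1 z.2))
    (by simp only [dynamics_eq]; fun_prop)
  simp only [hsymm (sys.dynamics _ _), ← two_mul, intervalIntegral.integral_const_mul] at hint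
  simp only [suppliedEnergy, inner_output, storedEnergy]
  rw [← h.2.1]
  refine (intervalIntegral.integral_add hp hd).trans ?_
  congr 1
  change ∫ r in (0 : ℝ)..T, inner ℝ (Qc (x r)) (sys.dynamics (x r) (u r)) =
    1 / 2 * inner ℝ (Qc (x T)) (x T) - 1 / 2 * inner ℝ (Qc (x 0)) (x 0)
  linarith

/-- Duality in place of a Gronwall estimate. For the adjoint solution with `q s = x s`, `‖x s‖² = ⟨q
0, x₀⟩ + ∫ ⟨q, (B - P)u⟩`. Both terms carry a factor `‖x s‖`, which is divided out. -/
theorem exists_norm_le_of_isPair (sys : PHSystem n m) (hU : IsCompact U) (N R : ℝ) :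
    ∃ K : ℝ, ∀ (T : ℝ) (x₀ : EuclideanSpace ℝ (Fin n)) (x : ℝ → EuclideanSpace ℝ (Fin n))
      (u : ℝ → EuclideanSpace ℝ (Fin m)), 0 ≤ T → T ≤ N → ‖x₀‖ ≤ R → sys.IsPair U T x₀ x u →
      ∀ s ∈ Icc 0 T, ‖x s‖ ≤ K := by
  let Φ := linearFlow (-(adjoint sys.driftCLM))
  obtain ⟨K, hK⟩ := (isCompact_Icc (a := -N) (b := 0)).exists_bound_of_continuousOn
    (continuous_linearFlow (-(adjoint sys.driftCLM))).continuousOn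
  obtain ⟨M, hM⟩ := hU.exists_bound_of_continuousOn (f := fun v => sys.inputCLM v)
    sys.inputCLM.continuous.continuousOn
  refine ⟨K * R + N * (K * |M|), fun T x₀ x u hT hTN hR h s hs => ?_⟩
  have hK0 : 0 ≤ K := (norm_nonneg _).trans (hK 0 ⟨by linarith, le_rfl⟩)
  let q : ℝ → EuclideanSpace ℝ (Fin n) := fun r => Φ (r - s) (x s)
  have hq : ∀ r, HasDerivAt q (-(adjoint sys.driftCLM (q r))) r := fun r =>
    hasDerivAt_linearFlow_apply (-(adjoint sys.driftCLM)) s (x s) r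
  have hqc : Continuous q := continuous_iff_continuousAt.2 fun r => (hq r).continuousAt
  have hqs : q s = x s := by simp [q, Φ, linearFlow_zero]
  have hqK : ∀ r ∈ Icc 0 s, ‖q r‖ ≤ K * ‖x s‖ := fun r hr =>
    (Φ (r - s)).le_of_opNorm_le (hK _ ⟨by linarith [hr.1, hs.2], by linarith [hr.2]⟩) _
  have hqac := absolutelyContinuousOnInterval_of_hasDerivAt hq (by fun_prop) 0 s
  have hxac : AbsolutelyContinuousOnInterval x 0 s := by
    refine h.2.2.1.mono ?_
    rw [uIcc_of_le hs.1, uIcc_of_le hT]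
    exact Icc_subset_Icc_right hs.2
  obtain ⟨-, hint⟩ := integral_inner_add_inner_eq_sub hqac hxac (ae_of_all _ hq)
    (h.ae_hasDerivAt le_rfl hs.1 hs.2)
  have hb : ‖∫ r in (0 : ℝ)..s, (inner ℝ (q r) (sys.dynamics (x r) (u r)) +
      inner ℝ (-(adjoint sys.driftCLM (q r))) (x r))‖ ≤ (K * ‖x s‖ * |M|) * |s - 0| := by
    refine intervalIntegral.norm_integral_le_of_norm_le_const_ae ?_
    have hu := h.1.2
    rw [ae_restrict_iff' measurableSet_Icc] at hu
    filter_upwards [hu] with r hr hrs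
    rw [uIoc_of_le hs.1] at hrs
    have e : inner ℝ (q r) (sys.dynamics (x r) (u r)) +
        inner ℝ (-(adjoint sys.driftCLM (q r))) (x r) = inner ℝ (q r) (sys.inputCLM (u r)) := by
      simp [dynamics_eq, inner_add_right, adjoint_inner_left]
    rw [e]
    refine (norm_inner_le_norm _ _).trans ?_
    exact mul_le_mul (hqK r ⟨hrs.1.le, hrs.2⟩)
      ((hM _ (hr ⟨hrs.1.le, hrs.2.trans hs.2⟩)).trans (le_abs_self M)) (norm_nonneg _)
      (by positivity)
  rw [hint, hqs, h.2.1, real_inner_self_eq_norm_mul_norm, sub_zero, abs_of_nonneg hs.1] at hb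
  have h1 : inner ℝ (q 0) x₀ ≤ K * ‖x s‖ * R :=
    (real_inner_le_norm _ _).trans
      (mul_le_mul (hqK 0 ⟨le_rfl, hs.1⟩) hR (norm_nonneg _) (by positivity))
  have h2 := (le_abs_self _).trans hb
  have h3 : K * ‖x s‖ * |M| * s ≤ K * ‖x s‖ * |M| * N := by
    gcongr
    exact hs.2.trans hTN
  rcases (norm_nonneg (x s)).eq_or_lt with h0 | h0
  · rw [← h0]
    have := (norm_nonneg x₀).trans hR
    have := hT.trans hTN
    positivity
  · refine le_of_mul_le_mul_left ?_ h0
    linarith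

end PHSystem

/-- Bounds an observation `b` by the integrand `b² / (1 + b)` produced by a saturated control, up to
an error `ε`. -/
theorem le_add_mul_sq_div {b ε : ℝ} (hb : 0 ≤ b) (hε : 0 < ε) :
    b ≤ ε + (1 + 1 / ε) * (b ^ 2 / (1 + b)) := by
  rcases le_total b ε with h | h
  · have : 0 ≤ (1 + 1 / ε) * (b ^ 2 / (1 + b)) := by positivity
    linarith
  · have h1 : 1 ≤ b / ε := (one_le_div hε).2 h
    have h2 : b ≤ (1 + 1 / ε) * (b ^ 2 / (1 + b)) := by
      rw [mul_div_assoc', le_div_iff₀ (by positivity)]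
      have : (1 + 1 / ε) * b ^ 2 = b * (b + b / ε) := by ring
      rw [this]
      exact mul_le_mul_of_nonneg_left (by linarith) hb
    linarith

/-! ### Null controllability with constrained controls. -/

namespace PHSystem

open ContinuousLinearMap Filter Topology

variable {n m : ℕ} {sys : PHSystem n m} {U : Set (EuclideanSpace ℝ (Fin m))}

/-- Reverse in time a steering of `(-A, -(B - P))` from `0` to `z`; the bound `M‖z‖` keeps the
controls in the ball of radius `ρ`. -/
theorem ball_subset_steerableAt (hctrl : sys.IsControllable) {ρ : ℝ} (hρ : 0 < ρ)
    (hρU : Metric.closedBall 0 ρ ⊆ U) :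
    ∃ r : ℝ, 0 < r ∧ Metric.ball 0 r ⊆ sys.steerableAt U 1 {0} := by
  obtain ⟨M, hM, H⟩ := (sys.kalmanCondition hctrl).neg.exists_bounded_steering one_pos
  refine ⟨ρ / M, by positivity, fun z hz => ?_⟩
  obtain ⟨v, ξ, hv, hξ, h0, h1, hb⟩ := H z
  have hp : sys.IsPair U 1 ((fun s => ξ (1 - s)) 0) (fun s => ξ (1 - s)) (fun s => v (1 - s)) := by
    refine isPair_of_hasDerivAt (x := fun s => ξ (1 - s)) (u := fun s => v (1 - s)) (by fun_prop)
      (fun s hs => hρU ?_) fun s => ?_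
    · rw [mem_closedBall_zero_iff]
      refine (hb (1 - s) ⟨by linarith [hs.2], by linarith [hs.1]⟩).1.trans ?_
      rw [mem_ball_zero_iff, lt_div_iff₀ hM] at hz
      linarith
    · convert! (hξ (1 - s)).comp_const_sub 1 s using 1
      simp only [neg_apply]
      abel
  simp only [sub_zero, h1] at hp
  exact ⟨_, _, hp, by simpa using h0⟩

theorem adjoint_driftCLM_neg (x : EuclideanSpace ℝ (Fin n)) :
    -(adjoint sys.driftCLM x) = Matrix.toEuclideanLin sys.Q
      (Matrix.toEuclideanLin (sys.J + sys.R) x) := by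
  rw [driftCLM, adjoint_toEuclideanLin, ← toEuclideanLin_mul_apply, A, Matrix.transpose_mul,
    Matrix.transpose_sub, Q_transpose, R_transpose, J_transpose,
    show sys.Q * (-sys.J - sys.R) = -(sys.Q * (sys.J + sys.R)) by
      rw [← Matrix.mul_neg, neg_add, sub_eq_add_neg]]
  simp

/-- The backward adjoint flow `q' = -Aᵀ q` of a port-Hamiltonian system stays away from zero. -/
theorem exists_adjoint_norm_ge (sys : PHSystem n m) {p : EuclideanSpace ℝ (Fin n)} (hp : p ≠ 0) :
    ∃ (q : ℝ → EuclideanSpace ℝ (Fin n)) (δ : ℝ), 0 < δ ∧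
      (∀ t, HasDerivAt q (-(adjoint sys.driftCLM (q t))) t) ∧ q 0 = p ∧ ∀ t, 0 ≤ t → δ ≤ ‖q t‖ := by
  simp only [adjoint_driftCLM_neg]
  refine exists_solution_norm_ge (Matrix.toEuclideanLin sys.Q).toContinuousLinearMap
    (Matrix.toEuclideanLin (sys.J + sys.R)).toContinuousLinearMap (fun x y => ?_) (fun x => ?_)
    (fun x hx => ?_) (fun x => ?_) hp
  · have := inner_toEuclideanLin_right sys.Q x y
    rw [Q_transpose] at this
    exact this.symm
  · rw [real_inner_comm]
    exact sys.inner_Q_nonneg x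
  · have h := (sys.Q_posSemidef.dotProduct_mulVec_zero_iff x.ofLp).1 (by
      rw [real_inner_comm] at hx
      simpa [EuclideanSpace.inner_eq_star_dotProduct, Matrix.toLpLin_apply] using hx)
    simp [Matrix.toLpLin_apply, h]
  · have h := sys.R_posSemidef.dotProduct_mulVec_nonneg x.ofLp
    have hJ := sys.inner_J_self x
    have hR : inner ℝ x (Matrix.toEuclideanLin sys.R x) = x.ofLp ⬝ᵥ sys.R *ᵥ x.ofLp := by
      rw [real_inner_comm]
      simp [EuclideanSpace.inner_eq_star_dotProduct, Matrix.toLpLin_apply]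
    rw [star_trivial] at h
    change 0 ≤ inner ℝ x (Matrix.toEuclideanLin (sys.J + sys.R) x)
    rw [map_add, LinearMap.add_apply, inner_add_right, hJ, zero_add, hR]
    exact h

/-- Every state can be steered to zero by bounded controls. -/
theorem exists_mem_steerableAt_zero (hU_convex : Convex ℝ U)
    (hU : (0 : EuclideanSpace ℝ (Fin m)) ∈ interior U)
    (hctrl : sys.IsControllable) (x₀ : EuclideanSpace ℝ (Fin n)) :
    ∃ k : ℕ, x₀ ∈ sys.steerableAt U k {0} := by
  have hU0 := interior_subset hU
  obtain ⟨ρ, hρ, hρU⟩ := Metric.nhds_basis_closedBall.mem_iff.1 (mem_interior_iff_mem_nhds.1 hU)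
  set C : Set (EuclideanSpace ℝ (Fin n)) := ⋃ k : ℕ, sys.steerableAt U k {0} with hCdef
  have hmono : Monotone fun k : ℕ => sys.steerableAt U k {0} := fun k l hkl =>
    steerableAt_zero_mono hU0 k.cast_nonneg (Nat.cast_le.2 hkl)
  have hCconv : Convex ℝ C := hmono.directed_le.convex_iUnion fun k =>
    convex_steerableAt hU_convex k (convex_singleton 0)
  by_contra hx₀
  have hx₀C : x₀ ∉ interior C := fun h => hx₀ (mem_iUnion.1 (interior_subset h))
  have h0C : (0 : EuclideanSpace ℝ (Fin n)) ∈ interior C := by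
    obtain ⟨r, hr, hrC⟩ := ball_subset_steerableAt hctrl hρ hρU
    refine mem_interior_iff_mem_nhds.2 (mem_of_superset (Metric.ball_mem_nhds 0 hr) ?_)
    refine hrC.trans ?_
    simpa using subset_iUnion (fun k : ℕ => sys.steerableAt U k {0}) 1
  -- Separation uses the open interior; the weak inequality passes to `C` because `C` lies in the
  -- closure of its interior.
  obtain ⟨f, hf⟩ := geometric_hahn_banach_open_point hCconv.interior isOpen_interior hx₀C
  set c := f x₀
  have hfC : ∀ y ∈ C, f y ≤ c := by
    intro y hy
    have hcl := hCconv.closure_interior_eq_closure_of_nonempty_interior ⟨0, h0C⟩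
    have hsub : closure (interior C) ⊆ {y | f y ≤ c} :=
      closure_minimal (fun y hy => (hf y hy).le) (isClosed_le f.continuous continuous_const)
    exact hsub (hcl ▸ subset_closure hy)
  let p := (InnerProductSpace.toDual ℝ (EuclideanSpace ℝ (Fin n))).symm f
  have hpf : ∀ y, inner ℝ p y = f y := fun y => InnerProductSpace.toDual_symm_apply
  have hp : p ≠ 0 := by
    intro h
    have h1 := hf 0 h0C
    have h2 := hpf x₀
    rw [h, inner_zero_left] at h2
    rw [map_zero] at h1
    exact h1.ne h2
  obtain ⟨q, δ, hδ, hq, hq0, hqδ⟩ := sys.exists_adjoint_norm_ge hp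
  have hqc : Continuous q := continuous_iff_continuousAt.2 fun t => (hq t).continuousAt
  let b : ℝ → EuclideanSpace ℝ (Fin m) := fun t => adjoint sys.inputCLM (q t)
  have hbc : Continuous b := by fun_prop
  have hb1 : ∀ t, 1 + ‖b t‖ ≠ 0 := fun t => by positivity
  let h : ℝ → ℝ := fun t => ‖b t‖ ^ 2 / (1 + ‖b t‖)
  have hhc : Continuous h := by fun_prop (disch := exact hb1)
  have hh0 : ∀ t, 0 ≤ h t := fun t => by positivity
  let I : ℕ → ℝ := fun k => ∫ t in (0 : ℝ)..k, h t
  have hI : ∀ k, I k ≤ c / ρ := by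
    intro k
    -- A continuous saturation of `-b` with values in the `ρ`-ball. The solution is made to vanish
    -- at time `k`, so `ξ 0 ∈ C`, and duality yields `ρ * I k = f (ξ 0) ≤ c`.
    let v : ℝ → EuclideanSpace ℝ (Fin m) := fun t => -((ρ / (1 + ‖b t‖)) • b t)
    have hv : Continuous v := by
      have : Continuous fun t => ρ / (1 + ‖b t‖) := by fun_prop (disch := exact hb1)
      fun_prop
    obtain ⟨ξ, hξ, hξk⟩ := exists_solution_of_continuous sys.driftCLM sys.inputCLM hv k 0
    have hvU : ∀ t ∈ Icc 0 (k : ℝ), v t ∈ U := fun t _ => hρU (by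
      rw [mem_closedBall_zero_iff, norm_neg, norm_smul, Real.norm_of_nonneg (by positivity),
        div_mul_eq_mul_div, div_le_iff₀ (by positivity)]
      gcongr
      linarith)
    have hmem : ξ 0 ∈ C := mem_iUnion.2 ⟨k, ξ, v, isPair_of_hasDerivAt hv hvU hξ, hξk⟩
    have hint := integral_inner_adjoint hv hq hξ 0 k
    have he : ∀ t, inner ℝ (adjoint sys.inputCLM (q t)) (v t) = -ρ * h t := fun t => by
      simp only [v, h, b, inner_neg_right, inner_smul_right, real_inner_self_eq_norm_sq]
      ring
    simp only [he, intervalIntegral.integral_const_mul, hξk, inner_zero_right, hq0, hpf] at hint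
    have := hfC _ hmem
    rw [le_div_iff₀ hρ]
    change (∫ t in (0 : ℝ)..k, h t) * ρ ≤ c
    linarith
  have hIdiff : ∀ k : ℕ, I (k + 1) - I k = ∫ t in (k : ℝ)..(k + 1), h t := fun k => by
    have := intervalIntegral.integral_add_adjacent_intervals (hhc.intervalIntegrable 0 k)
      (hhc.intervalIntegrable (μ := volume) k (k + 1))
    simp only [I, Nat.cast_add, Nat.cast_one]
    linarith
  have hImono : Monotone I := monotone_nat_of_le_succ fun k => by
    have : 0 ≤ ∫ t in (k : ℝ)..(k + 1), h t :=
      intervalIntegral.integral_nonneg (by linarith) fun t _ => hh0 t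
    linarith [hIdiff k]
  have hIlim := tendsto_atTop_ciSup hImono ⟨c / ρ, by rintro _ ⟨k, rfl⟩; exact hI k⟩
  have ha : Tendsto (fun k : ℕ => ∫ t in (k : ℝ)..(k + 1), h t) atTop (𝓝 0) := by
    simp only [← hIdiff]
    simpa using (hIlim.comp (tendsto_add_atTop_nat 1)).sub hIlim
  obtain ⟨M, hM, H⟩ := (sys.kalmanCondition hctrl).exists_bounded_steering one_pos
  -- Observability on a unit window: steering `0` to `z = q (k + 1)` over `[k, k + 1]` writes `‖z‖²`
  -- as `∫ ⟨b, v⟩`, with `v` bounded by `M‖z‖`.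
  have hlow : ∀ ε > 0, ∀ k : ℕ, δ ≤ M * (ε + (1 + 1 / ε) * ∫ t in (k : ℝ)..(k + 1), h t) := by
    intro ε hε k
    set z := q (k + 1) with hz
    have hδz : δ ≤ ‖z‖ := hqδ _ (by positivity)
    obtain ⟨v, ξ, hv, hξ, h0, h1, hb⟩ := H z
    have hint := integral_inner_adjoint (v := fun t => v (t - k)) (ξ := fun t => ξ (t - k))
      (by fun_prop) hq (fun t => (hξ (t - k)).comp_sub_const t k) k (k + 1)
    simp only [sub_self, add_sub_cancel_left, h0, h1, inner_zero_right, sub_zero, ← hz,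
      real_inner_self_eq_norm_mul_norm] at hint
    have hle : ∫ t in (k : ℝ)..(k + 1), inner ℝ (adjoint sys.inputCLM (q t)) (v (t - k)) ≤
        ∫ t in (k : ℝ)..(k + 1), M * ‖z‖ * (ε + (1 + 1 / ε) * h t) := by
      refine intervalIntegral.integral_mono_on (by linarith)
        (Continuous.intervalIntegrable (by fun_prop) _ _)
        (Continuous.intervalIntegrable (by fun_prop) _ _) fun t ht => ?_
      refine (real_inner_le_norm _ _).trans ?_
      rw [mul_comm]
      exact mul_le_mul (hb (t - k) ⟨by linarith [ht.1], by linarith [ht.2]⟩).1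
        (le_add_mul_sq_div (norm_nonneg _) hε) (norm_nonneg _) (by positivity)
    rw [hint, intervalIntegral.integral_const_mul, intervalIntegral.integral_add
      (by simp) ((hhc.const_mul _).intervalIntegrable _ _),
      intervalIntegral.integral_const_mul] at hle
    simp only [intervalIntegral.integral_const, add_sub_cancel_left, one_smul] at hle
    have hzpos : 0 < ‖z‖ := hδ.trans_le hδz
    refine hδz.trans (le_of_mul_le_mul_left ?_ hzpos)
    linarith
  -- With this `ε` the limit `k → ∞` reads `δ ≤ δ / 2`.
  have hε : 0 < δ / (2 * M) := by positivity
  have hlim := ge_of_tendsto' (((ha.const_mul (1 + 1 / (δ / (2 * M)))).const_add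
    (δ / (2 * M))).const_mul M) (hlow _ hε)
  have : M * (δ / (2 * M)) = δ / 2 := by field_simp
  rw [mul_zero, add_zero, this] at hlim
  linarith

/-- Some simplex has `x₀` in its interior. A common time serves its finitely many vertices, hence by
convexity the whole simplex. -/
theorem eventually_mem_steerableAt_zero (hU_convex : Convex ℝ U)
    (hU : (0 : EuclideanSpace ℝ (Fin m)) ∈ interior U)
    (hctrl : sys.IsControllable) (x₀ : EuclideanSpace ℝ (Fin n)) :
    ∃ N : ℕ, ∀ᶠ y in 𝓝 x₀, y ∈ sys.steerableAt U N {0} := by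
  obtain ⟨b, hb, -⟩ := exists_mem_interior_convexHull_affineBasis (univ_mem : univ ∈ 𝓝 x₀)
  choose k hk using fun i => exists_mem_steerableAt_zero hU_convex hU hctrl (b i)
  refine ⟨Finset.univ.sup k, mem_of_superset (mem_interior_iff_mem_nhds.1 hb) ?_⟩
  refine convexHull_min ?_ (convex_steerableAt hU_convex _ (convex_singleton 0))
  rintro _ ⟨i, rfl⟩
  exact steerableAt_zero_mono (interior_subset hU) (Nat.cast_nonneg _)
    (Nat.cast_le.2 (Finset.le_sup (Finset.mem_univ i))) (hk i)

end PHSystem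

/-- For the antiderivative `D`, shifting one integral leaves `∫ D` over `[T - 2c, T - c]` minus `∫
D` over `[c, 2c]`. Since `D` is monotone and nonnegative, this is at most `c * D T`. -/
theorem integral_integral_sub_le {f : ℝ → ℝ} {c T : ℝ} (hf : ∀ t, 0 ≤ f t)
    (hfi : IntervalIntegrable f volume 0 T) (hc : 0 < c) (hcT : 3 * c ≤ T) :
    IntervalIntegrable (fun t => ∫ s in (t - c)..t, f s) volume (2 * c) (T - c) ∧
    ∫ t in (2 * c)..(T - c), (∫ s in (t - c)..t, f s) ≤ c * ∫ t in (0 : ℝ)..T, f t := by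
  have hsub : ∀ {a b : ℝ}, a ∈ Icc 0 T → b ∈ Icc 0 T → IntervalIntegrable f volume a b := by
    intro a b ha hb
    refine hfi.mono_set ?_
    rw [uIcc_of_le (ha.1.trans ha.2)]
    exact uIcc_subset_Icc ha hb
  let D : ℝ → ℝ := fun t => ∫ s in (0 : ℝ)..t, f s
  have h0 : (0 : ℝ) ∈ Icc 0 T := ⟨le_rfl, by linarith⟩
  have hD : ∀ {a b : ℝ}, a ∈ Icc 0 T → b ∈ Icc 0 T → D b - D a = ∫ s in a..b, f s := fun ha hb =>
    intervalIntegral.integral_interval_sub_left (hsub h0 hb) (hsub h0 ha)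
  have hmono : MonotoneOn D (Icc 0 T) := fun a ha b hb hab => by
    have : 0 ≤ ∫ s in a..b, f s := intervalIntegral.integral_nonneg hab fun t _ => hf t
    linarith [hD ha hb]
  have hDi : ∀ {a b : ℝ}, a ∈ Icc 0 T → b ∈ Icc 0 T → IntervalIntegrable D volume a b :=
    fun ha hb => (hmono.mono (uIcc_subset_Icc ha hb)).intervalIntegrable
  have m1 : c ∈ Icc 0 T := ⟨by linarith, by linarith⟩
  have m2 : 2 * c ∈ Icc 0 T := ⟨by linarith, by linarith⟩
  have m3 : T - 2 * c ∈ Icc 0 T := ⟨by linarith, by linarith⟩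
  have m4 : T - c ∈ Icc 0 T := ⟨by linarith, by linarith⟩
  have hDs : IntervalIntegrable (fun t => D (t - c)) volume (2 * c) (T - c) := by
    convert! (hDi m1 m3).comp_sub_right c using 1 <;> ring
  have hle : 2 * c ≤ T - c := by linarith
  have e : EqOn (fun t => D t - D (t - c)) (fun t => ∫ s in (t - c)..t, f s)
      (uIcc (2 * c) (T - c)) := fun t ht => by
    rw [uIcc_of_le hle] at ht
    exact hD ⟨by linarith [ht.1], by linarith [ht.2]⟩ ⟨by linarith [ht.1], by linarith [ht.2]⟩
  refine ⟨((hDi m2 m4).sub hDs).congr (e.mono uIoc_subset_uIcc), ?_⟩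
  rw [← intervalIntegral.integral_congr e, intervalIntegral.integral_sub (hDi m2 m4) hDs,
    intervalIntegral.integral_comp_sub_right,
    show 2 * c - c = c by ring, show T - c - c = T - 2 * c by ring]
  have a1 := intervalIntegral.integral_add_adjacent_intervals (hDi m1 m2) (hDi m2 m4)
  have a2 := intervalIntegral.integral_add_adjacent_intervals (hDi m1 m3) (hDi m3 m4)
  have a3 : 0 ≤ ∫ t in c..(2 * c), D t :=
    intervalIntegral.integral_nonneg (by linarith) fun t ht =>
      intervalIntegral.integral_nonneg (by linarith [ht.1]) fun s _ => hf s
  have a4 : ∫ t in (T - 2 * c)..(T - c), D t ≤ ∫ _ in (T - 2 * c)..(T - c), D T :=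
    intervalIntegral.integral_mono_on (by linarith) (hDi m3 m4) (by simp) fun t ht =>
      hmono ⟨by linarith [ht.1], by linarith [ht.2]⟩ ⟨by linarith, le_rfl⟩ (by linarith [ht.2])
  rw [intervalIntegral.integral_const, smul_eq_mul] at a4
  have e5 : (T - c - (T - 2 * c)) * D T = c * D T := by ring
  change _ ≤ c * D T
  linarith

/-! ### Dissipation bound, adjoint estimate and turnpike. -/

namespace PHSystem

open ContinuousLinearMap Filter Topology

variable {n m : ℕ} {sys : PHSystem n m} {U : Set (EuclideanSpace ℝ (Fin m))}

theorem IsPair.integral_dissipation_concatAt {t s : ℝ} {x₀ : EuclideanSpace ℝ (Fin n)}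
    {x x' : ℝ → EuclideanSpace ℝ (Fin n)} {u u' : ℝ → EuclideanSpace ℝ (Fin m)}
    (hU : IsCompact U) (ht : 0 ≤ t) (hs : 0 ≤ s) (h : sys.IsPair U t x₀ x u)
    (h' : sys.IsPair U s (x t) x' u') :
    ∫ r in (0 : ℝ)..(t + s), sys.dissipation (_root_.concatAt t x x' r) (_root_.concatAt t u u' r) =
      (∫ r in (0 : ℝ)..t, sys.dissipation (x r) (u r)) +
        ∫ r in (0 : ℝ)..s, sys.dissipation (x' r) (u' r) := by
  rw [← (integral_concatAt ht hs (h.intervalIntegrable_comp hU ht sys.continuous_dissipation)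
    (h'.intervalIntegrable_comp hU hs sys.continuous_dissipation)).2]
  congr 1
  ext r
  unfold _root_.concatAt
  split_ifs <;> rfl

theorem minTime_nonneg (x₀ z : EuclideanSpace ℝ (Fin n)) : 0 ≤ sys.minTime U x₀ z :=
  Real.sInf_nonneg fun _ h => h.1

/-- The dissipated energy along optimal pairs is bounded, locally uniformly in the initial state
and uniformly in the horizon. -/
theorem eventually_integral_dissipation_le (hU_convex : Convex ℝ U) (hU_compact : IsCompact U)
    (hU : (0 : EuclideanSpace ℝ (Fin m)) ∈ interior U) (hctrl : sys.IsControllable)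
    {Φ : Set (EuclideanSpace ℝ (Fin n))} {T₁ : ℝ} (hT₁ : 0 ≤ T₁)
    (hreach : (0 : EuclideanSpace ℝ (Fin n)) ∈ sys.steerableAt U T₁ Φ)
    (x₀ : EuclideanSpace ℝ (Fin n)) :
    ∃ K : ℝ, ∀ᶠ y in 𝓝 x₀, ∀ (T : ℝ) (x : ℝ → EuclideanSpace ℝ (Fin n))
      (u : ℝ → EuclideanSpace ℝ (Fin m)), sys.minTime U y 0 + T₁ < T →
      sys.IsOptimalPair U Φ T y x u →
      ∫ t in (0 : ℝ)..T, sys.dissipation (x t) (u t) ≤ K := by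
  obtain ⟨N, hN⟩ := eventually_mem_steerableAt_zero hU_convex hU hctrl x₀
  obtain ⟨x₁, u₁, hp₁, hxΦ⟩ := hreach
  obtain ⟨K₁, hK₁⟩ := sys.exists_norm_le_of_isPair hU_compact (N + 1) (‖x₀‖ + 1)
  obtain ⟨K₂, hK₂⟩ := ((isCompact_closedBall (0 : EuclideanSpace ℝ (Fin n)) K₁).prod
    hU_compact).exists_bound_of_continuousOn sys.continuous_dissipation.continuousOn
  refine ⟨sys.storedEnergy (x₁ T₁) + |K₂| * (N + 1) +
    ∫ t in (0 : ℝ)..T₁, sys.dissipation (x₁ t) (u₁ t), ?_⟩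
  filter_upwards [hN, Metric.ball_mem_nhds x₀ one_pos] with y hy hyball T x u hT hopt
  have hyR : ‖y‖ ≤ ‖x₀‖ + 1 := by
    have h1 := norm_add_le x₀ (y - x₀)
    rw [add_sub_cancel] at h1
    rw [mem_ball_iff_norm] at hyball
    linarith
  have hmt0 := sys.minTime_nonneg (U := U) y 0
  have hmtN : sys.minTime U y 0 ≤ N := csInf_le ⟨0, fun _ h => h.1⟩ ⟨N.cast_nonneg, hy⟩
  -- The minimal time need not be attained here. A nearby `t < T - T₁` leaves time for the final
  -- leg, and `t < minTime + 1` gives the uniform bound `t ≤ N + 1`.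
  obtain ⟨t, ⟨ht0, xa, ua, hpa, hxa⟩, ht⟩ := exists_lt_of_csInf_lt
    (s := {t : ℝ | 0 ≤ t ∧ y ∈ sys.steerableAt U t {0}}) ⟨N, N.cast_nonneg, hy⟩
    (show sys.minTime U y 0 < min (T - T₁) (sys.minTime U y 0 + 1) from
      lt_min (by linarith) (by linarith))
  rw [mem_singleton_iff] at hxa
  obtain ⟨ht1, ht2⟩ := lt_min_iff.1 ht
  have htN : t ≤ N + 1 := by linarith
  have hs : 0 ≤ T - T₁ - t := by linarith
  have hp0 : sys.IsPair U (T - T₁ - t) (xa t) (fun _ => 0) (fun _ => 0) := by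
    rw [hxa]
    exact isPair_zero (interior_subset hU) _
  have hpb := hpa.concatAt ht0 hs hp0
  have hxb := concatAt_add (f := xa) (g := fun _ => 0) hs hxa.symm
  have hd0 : sys.dissipation (0 : EuclideanSpace ℝ (Fin n)) 0 = 0 := by
    simp [dissipation_eq]
  have hdb := hpa.integral_dissipation_concatAt hU_compact ht0 hs hp0
  simp only [hd0, intervalIntegral.integral_zero, add_zero] at hdb
  rw [← hxb] at hp₁
  have hts : 0 ≤ t + (T - T₁ - t) := by linarith
  have hpc := hpb.concatAt hts hT₁ hp₁
  have hxc := concatAt_add (f := concatAt t xa fun _ => 0) (g := x₁) hT₁ hp₁.2.1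
  have hdc := hpb.integral_dissipation_concatAt hU_compact hts hT₁ hp₁
  rw [show t + (T - T₁ - t) + T₁ = T by ring] at hpc hxc hdc
  have hT0 : 0 ≤ T := by linarith
  -- The initial stored energies cancel in this comparison, and the resting phase contributes
  -- nothing, so its length is irrelevant.
  have hle := hopt.2 _ _ hpc (by rw [hxc]; exact hxΦ)
  rw [hopt.1.1.suppliedEnergy_eq hU_compact hT0, hpc.suppliedEnergy_eq hU_compact hT0, hxc, hdc,
    hdb] at hle
  have hda : ‖∫ r in (0 : ℝ)..t, sys.dissipation (xa r) (ua r)‖ ≤ |K₂| * |t - 0| := by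
    refine intervalIntegral.norm_integral_le_of_norm_le_const_ae ?_
    have hua := hpa.1.2
    rw [ae_restrict_iff' measurableSet_Icc] at hua
    filter_upwards [hua] with r hr hrt
    rw [uIoc_of_le ht0] at hrt
    have hrt' : r ∈ Icc 0 t := Ioc_subset_Icc_self hrt
    refine (hK₂ (xa r, ua r) ⟨?_, hr hrt'⟩).trans (le_abs_self _)
    rw [mem_closedBall_zero_iff]
    exact hK₁ t y xa ua ht0 htN hyR hpa r hrt'
  rw [sub_zero, abs_of_nonneg ht0] at hda
  have h1 := (le_abs_self _).trans hda
  have h2 : |K₂| * t ≤ |K₂| * (N + 1) := by gcongr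
  have h3 := storedEnergy_nonneg (sys := sys) (x T)
  linarith

/-- Pointwise observability estimate for the adjoint on the part of the horizon where the control
is interior. -/
theorem exists_adjoint_norm_sq_le (hU_compact : IsCompact U) (hctrl : sys.IsControllable) {tc : ℝ}
    (htc : 0 < tc) :
    ∃ c : ℝ, 0 ≤ c ∧ ∀ (T : ℝ) (x₀ : EuclideanSpace ℝ (Fin n)) (x : ℝ → EuclideanSpace ℝ (Fin n))
      (u : ℝ → EuclideanSpace ℝ (Fin m)) (lam : ℝ → EuclideanSpace ℝ (Fin n)) (lam₀ : ℝ),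
      sys.IsPair U T x₀ x u → sys.IsAdjoint U T x u lam lam₀ →
      (∀ᵐ t ∂volume.restrict (Icc tc (T - tc)), u t ∈ interior U) →
      ∀ t ∈ Icc (2 * tc) (T - tc),
        ‖lam t‖ ^ 2 ≤ lam₀ ^ 2 * c * ∫ s in (t - tc)..t, sys.dissipation (x s) (u s) := by
  obtain ⟨M, hM, H⟩ := (sys.kalmanCondition hctrl).exists_bounded_steering htc
  obtain ⟨C, hC, hdiss⟩ := sys.exists_norm_diss_sq_le
  refine ⟨8 * tc * M ^ 2 * C, by positivity, fun T x₀ x u lam lam₀ hp hadj hint t ht => ?_⟩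
  set z := lam t with hz
  obtain ⟨v, ξ, hv, hξ, h0, h1, hb⟩ := H z
  let ξ' : ℝ → EuclideanSpace ℝ (Fin n) := fun s => ξ (s - (t - tc))
  have hξ' : ∀ s, HasDerivAt ξ' (sys.driftCLM (ξ' s) + sys.inputCLM (v (s - (t - tc)))) s :=
    fun s => (hξ _).comp_sub_const s _
  have hξc : Continuous ξ' := continuous_iff_continuousAt.2 fun s => (hξ' s).continuousAt
  have hT : 0 ≤ T := by linarith [ht.1, ht.2]
  have hle : t - tc ≤ t := by linarith
  have hsubT : Icc (t - tc) t ⊆ Icc 0 T :=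
    Icc_subset_Icc (by linarith [ht.1]) (by linarith [ht.2])
  -- The lower limit `2 * tc` puts the whole observation window where the control is interior.
  have hsubc : Icc (t - tc) t ⊆ Icc tc (T - tc) :=
    Icc_subset_Icc (by linarith [ht.1]) ht.2
  have hIoc : uIoc (t - tc) t ⊆ Icc (t - tc) t := by
    rw [uIoc_of_le hle]
    exact Ioc_subset_Icc_self
  have hac : AbsolutelyContinuousOnInterval lam (t - tc) t := by
    refine hadj.adjoint_eq.1.mono ?_
    rwa [uIcc_of_le hT, uIcc_of_le hle]
  have hder := ae_restrict_of_ae_restrict_of_subset (hIoc.trans hsubT) hadj.adjoint_eq.2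
  simp only [gradient_controlHamiltonian] at hder
  obtain ⟨hi, he⟩ := integral_inner_add_inner_eq_sub hac
    (absolutelyContinuousOnInterval_of_hasDerivAt hξ' (by fun_prop) (t - tc) t) hder
    (ae_of_all _ hξ')
  have e1 : ξ' t = z := by simp [ξ', h1]
  have e0 : ξ' (t - tc) = 0 := by simp [ξ', h0]
  rw [e1, e0, inner_zero_right, sub_zero, ← hz, real_inner_self_eq_norm_sq] at he
  have hd := (hp.intervalIntegrable_comp hU_compact hT sys.continuous_dissipation).mono_set
    (c := t - tc) (d := t) (by rwa [uIcc_of_le hT, uIcc_of_le hle])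
  -- Testing `λ` against `ξ'`, which runs from `0` to `λ(t)`, gives `‖λ(t)‖² = -2λ₀ ∫ (⟨w₂, v⟩ +
  -- ⟨w₁, ξ'⟩)`. Young's weight is chosen so that the first term integrates to `‖z‖² / 2` and can be
  -- absorbed.
  have hbound : ‖z‖ ^ 2 ≤ ∫ s in (t - tc)..t, (‖z‖ ^ 2 / (2 * tc) +
      4 * tc * lam₀ ^ 2 * M ^ 2 * C * sys.dissipation (x s) (u s)) := by
    refine he.symm.le.trans ?_
    refine intervalIntegral.integral_mono_ae_restrict hle hi
      ((by simp : IntervalIntegrable (fun _ => ‖z‖ ^ 2 / (2 * tc)) volume (t - tc) t).add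
        (hd.const_mul _)) ?_
    filter_upwards [ae_restrict_of_ae_restrict_of_subset hsubT hadj.maximum,
      ae_restrict_of_ae_restrict_of_subset hsubc hint, ae_restrict_mem measurableSet_Icc]
      with s hmax hus hs
    have hB := sys.adjoint_inputCLM_eq_of_isMaxOn hus hmax.2
    set w₁ := sys.dissState (x s) (u s)
    set w₂ := sys.dissInput (x s) (u s)
    have hw := hdiss (x s) (u s)
    obtain ⟨hbv, hbξ⟩ := hb (s - (t - tc)) ⟨by linarith [hs.1], by linarith [hs.2]⟩
    have e2 : inner ℝ (lam s) (sys.driftCLM (ξ' s) + sys.inputCLM (v (s - (t - tc)))) +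
        inner ℝ (-(adjoint sys.driftCLM (lam s) + (2 * lam₀) • w₁)) (ξ' s) =
        -(2 * lam₀) * (inner ℝ w₂ (v (s - (t - tc))) + inner ℝ w₁ (ξ' s)) := by
      rw [inner_add_right, ← adjoint_inner_left sys.inputCLM, hB, inner_neg_left, inner_add_left,
        adjoint_inner_left, inner_smul_left, inner_smul_left]
      simp only [conj_trivial]
      ring
    rw [e2]
    have e3 : |inner ℝ w₂ (v (s - (t - tc))) + inner ℝ w₁ (ξ' s)| ≤
        (‖w₁‖ + ‖w₂‖) * (M * ‖z‖) := by
      refine (abs_add_le _ _).trans ?_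
      have i1 := (abs_real_inner_le_norm w₂ (v (s - (t - tc)))).trans
        (mul_le_mul_of_nonneg_left hbv (norm_nonneg _))
      have i2 := (abs_real_inner_le_norm w₁ (ξ' s)).trans
        (mul_le_mul_of_nonneg_left hbξ (norm_nonneg _))
      linarith
    set a := inner ℝ w₂ (v (s - (t - tc))) + inner ℝ w₁ (ξ' s)
    have e4 : -(2 * lam₀) * a ≤ 2 * |lam₀| * ((‖w₁‖ + ‖w₂‖) * (M * ‖z‖)) := by
      refine (le_abs_self _).trans ?_
      rw [abs_mul, abs_neg, abs_mul, abs_two]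
      gcongr
    have e5 : 2 * |lam₀| * ((‖w₁‖ + ‖w₂‖) * (M * ‖z‖)) ≤
        ‖z‖ ^ 2 / (2 * tc) + 2 * tc * lam₀ ^ 2 * M ^ 2 * (‖w₁‖ + ‖w₂‖) ^ 2 := by
      have hsq : 0 ≤ (‖z‖ - 2 * tc * |lam₀| * M * (‖w₁‖ + ‖w₂‖)) ^ 2 / (2 * tc) := by positivity
      have hexp : (‖z‖ - 2 * tc * |lam₀| * M * (‖w₁‖ + ‖w₂‖)) ^ 2 / (2 * tc) =
          ‖z‖ ^ 2 / (2 * tc) + 2 * tc * |lam₀| ^ 2 * M ^ 2 * (‖w₁‖ + ‖w₂‖) ^ 2 -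
            2 * |lam₀| * ((‖w₁‖ + ‖w₂‖) * (M * ‖z‖)) := by
        field_simp
        ring
      rw [hexp, sq_abs] at hsq
      linarith
    have e6 : (‖w₁‖ + ‖w₂‖) ^ 2 ≤ 2 * (C * sys.dissipation (x s) (u s)) := by
      nlinarith [sq_nonneg (‖w₁‖ - ‖w₂‖)]
    have e7 := mul_le_mul_of_nonneg_left e6
      (show 0 ≤ 2 * tc * lam₀ ^ 2 * M ^ 2 by positivity)
    linarith
  rw [intervalIntegral.integral_add (by simp) (hd.const_mul _),
    intervalIntegral.integral_const, intervalIntegral.integral_const_mul, smul_eq_mul,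
    show (t - (t - tc)) * (‖z‖ ^ 2 / (2 * tc)) = ‖z‖ ^ 2 / 2 by field_simp; ring] at hbound
  linarith

end PHSystem

/-- Here `T₁` is a time at which the target set `Φ` can be reached from `0`, so that
`sys.minTime U x₀ 0 + T₁` is the horizon threshold `T(x₀)`. The bound `G` depends only on the
system, `U`, `Φ`, `T₁` and `tc`. -/
theorem mainTheorem3 {n m : ℕ} (sys : PHSystem n m)
    (U : Set (EuclideanSpace ℝ (Fin m))) (hU_convex : Convex ℝ U) (hU_compact : IsCompact U)
    (hU_zero : (0 : EuclideanSpace ℝ (Fin m)) ∈ interior U)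
    (Φ : Set (EuclideanSpace ℝ (Fin n))) (hΦ : IsClosed Φ)
    (hctrl : sys.IsControllable)
    (T₁ : ℝ) (hT₁ : 0 ≤ T₁)
    (hreach : (0 : EuclideanSpace ℝ (Fin n)) ∈ sys.steerableAt U T₁ Φ)
    (tc : ℝ) (htc : 0 < tc) :
    ∃ G : EuclideanSpace ℝ (Fin n) → ℝ, Continuous G ∧ (∀ x₀, 0 ≤ G x₀) ∧
      ∀ (x₀ : EuclideanSpace ℝ (Fin n)) (T : ℝ), sys.minTime U x₀ 0 + T₁ < T → tc < T / 4 →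
      ∀ (x : ℝ → EuclideanSpace ℝ (Fin n)) (u : ℝ → EuclideanSpace ℝ (Fin m))
        (lam : ℝ → EuclideanSpace ℝ (Fin n)) (lam₀ : ℝ),
        sys.IsOptimalPair U Φ T x₀ x u →
        sys.IsAdjoint U T x u lam lam₀ →
        (∀ᵐ t ∂volume.restrict (Icc tc (T - tc)), u t ∈ interior U) →
        (∫ t in (2 * tc)..(T - tc), ‖lam t‖ ^ 2) ≤ lam₀ ^ 2 * G x₀ := by
  -- Admissible dissipation bounds form an upper set, hence a convex one, and locally a constant
  -- belongs to all of them. A partition of unity then selects a continuous bound.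
  let S : EuclideanSpace ℝ (Fin n) → Set ℝ := fun y => {K | 0 ≤ K ∧
    ∀ (T : ℝ) (x : ℝ → EuclideanSpace ℝ (Fin n)) (u : ℝ → EuclideanSpace ℝ (Fin m)),
      sys.minTime U y 0 + T₁ < T → sys.IsOptimalPair U Φ T y x u →
      ∫ t in (0 : ℝ)..T, sys.dissipation (x t) (u t) ≤ K}
  obtain ⟨g, hg⟩ := exists_continuous_forall_mem_convex_of_local_const (t := S)
    (fun y => by
      have h : IsUpperSet (S y) := fun a b hab ha =>
        ⟨ha.1.trans hab, fun T x u hT h => (ha.2 T x u hT h).trans hab⟩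
      exact h.ordConnected.convex)
    (fun x₀ => by
      obtain ⟨K, hK⟩ := PHSystem.eventually_integral_dissipation_le hU_convex hU_compact hU_zero
        hctrl hT₁ hreach x₀
      refine ⟨|K|, ?_⟩
      filter_upwards [hK] with y hy
      exact ⟨abs_nonneg K, fun T x u hT h => (hy T x u hT h).trans (le_abs_self K)⟩)
  obtain ⟨c, hc, hlam⟩ := PHSystem.exists_adjoint_norm_sq_le hU_compact hctrl htc
  refine ⟨fun y => c * tc * g y, by fun_prop, fun y => mul_nonneg (by positivity) (hg y).1, ?_⟩
  intro x₀ T hT htcT x u lam lam₀ hopt hadj hint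
  have hT0 : 0 ≤ T := by linarith
  have hd := hopt.1.1.intervalIntegrable_comp hU_compact hT0 sys.continuous_dissipation
  obtain ⟨hi, hle⟩ := integral_integral_sub_le (fun t => sys.dissipation_nonneg (x t) (u t)) hd htc
    (by linarith)
  have hlamc : ContinuousOn lam (uIcc (2 * tc) (T - tc)) := by
    refine hadj.adjoint_eq.1.continuousOn.mono ?_
    rw [uIcc_of_le (by linarith), uIcc_of_le hT0]
    exact Icc_subset_Icc (by linarith) (by linarith)
  calc ∫ t in (2 * tc)..(T - tc), ‖lam t‖ ^ 2
      ≤ ∫ t in (2 * tc)..(T - tc), lam₀ ^ 2 * c *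
          ∫ s in (t - tc)..t, sys.dissipation (x s) (u s) :=
        intervalIntegral.integral_mono_on (by linarith) (hlamc.norm.pow 2).intervalIntegrable
          (hi.const_mul _) fun t ht => hlam T x₀ x u lam lam₀ hopt.1.1 hadj hint t ht
    _ = lam₀ ^ 2 * c * ∫ t in (2 * tc)..(T - tc),
          ∫ s in (t - tc)..t, sys.dissipation (x s) (u s) :=
        intervalIntegral.integral_const_mul _ _
    _ ≤ lam₀ ^ 2 * c * (tc * g x₀) := by
        refine mul_le_mul_of_nonneg_left (hle.trans ?_) (by positivity)
        exact mul_le_mul_of_nonneg_left ((hg x₀).2 T x u hT hopt) htc.le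
    _ = lam₀ ^ 2 * (c * tc * g x₀) := by ring
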